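/- Let $\beta>0$, $\lambda>0$, $\nu\in(0,1)$. Consider the following generalized Yule model of a growing network. One webpage is present at time $0$, and the number of webpages is a Yule process of rate $\beta$: with $k$ webpages present, the next one is created after an exponential time of rate $\beta k$, these times being independent. The number of in-links of each webpage, as a function of its age, is an independent copy of the fractional Yule process $\mathfrak N^\nu_{\rm lin}$, and these copies are independent of the creation of the webpages. Here $\mathfrak N^\nu_{\rm lin}$ is the fractional birth process with linear rates $\lambda_r=\lambda r$: a counting process with right-continuous nondecreasing paths increasing by unit jumps, started from $1$, whose state probabilities $p_n(t)=\mathbb P(\mathfrak N^\nu_{\rm lin}(t)=n)$ are locally absolutely continuous on $[0,\infty)$ and satisfy, with the convention $p_0=0$, $$\frac{1}{\Gamma(1-\nu)}\int_0^t \frac{p_n'(s)}{(t-s)^{\nu}}\,ds=-\lambda n\,p_n(t)+\lambda(n-1)\,p_{n-1}(t),\qquad p_n(0)=\delta_{n,1},\qquad n\ge 1,\ t>0 .$$ For $t>0$ choose a webpage uniformly at random among those present at time $t$ and let ${}_tN$ be its number of in-links at time $t$. Let $q_t(n)$ be the conditional probability of ${}_tN=n$ given that the chosen webpage was created after time $0$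 (i.e. it is not the initial webpage). Write $\gamma(a,x)=\int_0^x u^{a-1}e^{-u}du$ and $\Gamma(a,x)=\int_x^\infty u^{a-1}e^{-u}du$. (i) For all $t>0$ and $n\ge1$, $$q_t(n)=\frac{\beta}{1-e^{-\beta t}}\left[\frac{\beta^{\nu-1}}{\lambda}\,\frac{\Gamma\left(\frac{\beta^\nu}{\lambda}+1\right)\Gamma(n)}{\Gamma\left(\frac{\beta^\nu}{\lambda}+n+1\right)}-\int_t^\infty e^{-\beta y}\,\mathbb P(\mathfrak N^\nu_{\rm lin}(y)=n)\,dy\right],$$ the integral being convergent, and $$q_t(n)=\frac{1}{1-e^{-\beta t}}\sum_{j=1}^n\binom{n-1}{j-1}(-1)^{j-1}\sum_{r=0}^\infty\frac{\gamma(\nu r+1,\beta t)}{\Gamma(\nu r+1)}\left(-\frac{\lambda j}{\beta^\nu}\right)^r,$$ where all the series converge. (ii) For $t>0$ and an integer $j\ge1$, the series $\sum_{r\ge0}\frac{\Gamma(\nu r+1,\beta t)}{\Gamma(\nu r+1)}\left(-\frac{\lambda j}{\beta^\nu}\right)^r$ converges absolutely if and only if $\lambda j<\beta^\nu$. If $\lambda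 n<\beta^\nu$, then $$q_t(n)=\frac{1}{1-e^{-\beta t}}\left[\frac{\beta^{\nu}}{\lambda}\,\frac{\Gamma\left(\frac{\beta^\nu}{\lambda}+1\right)\Gamma(n)}{\Gamma\left(\frac{\beta^\nu}{\lambda}+n+1\right)}-\sum_{j=1}^n\binom{n-1}{j-1}(-1)^{j-1}\sum_{r=0}^\infty\frac{\Gamma(\nu r+1,\beta t)}{\Gamma(\nu r+1)}\left(-\frac{\lambda j}{\beta^\nu}\right)^r\right].$$ (iii) For every $n\ge1$, $$\lim_{t\to\infty}q_t(n)=\lim_{t\to\infty}\mathbb P({}_tN=n)=\frac{\beta^\nu}{\lambda}\,\frac{\Gamma\left(\frac{\beta^\nu}{\lambda}+1\right)\Gamma(n)}{\Gamma\left(\frac{\beta^\nu}{\lambda}+n+1\right)},$$ and these limits sum to $1$ over $n\ge1$: they form the classical Yule--Simon distribution of parameter $\rho^{-1}=\beta^\nu/\lambda$. -/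

import Mathlib

open MeasureTheory ProbabilityTheory Filter Topology
open scoped NNReal ENNReal

namespace FractionalYule

/-- The lower incomplete Gamma function `γ(a, x)`. -/
noncomputable def lowerGamma (a x : ℝ) : ℝ :=
  ∫ u in (0 : ℝ)..x, u ^ (a - 1) * Real.exp (-u)

/-- The upper incomplete Gamma function `Γ(a, x)`. -/
noncomputable def upperGamma (a x : ℝ) : ℝ :=
  ∫ u in Set.Ioi x, u ^ (a - 1) * Real.exp (-u)

/-- The probability that the classical Yule–Simon distribution of parameter `a` gives to `n ≥ 1`. -/
noncomputable def yuleSimon (a : ℝ) (n : ℕ) : ℝ :=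
  a * (Real.Gamma (a + 1) * Real.Gamma n / Real.Gamma (a + n + 1))

/-- The Caputo derivative of order `ν ∈ (0, 1)`, with base point `0`, of `f` at `t > 0`. -/
noncomputable def caputoDeriv (ν : ℝ) (f : ℝ → ℝ) (t : ℝ) : ℝ :=
  (Real.Gamma (1 - ν))⁻¹ * ∫ s in (0 : ℝ)..t, deriv f s / (t - s) ^ ν

section Model

variable {Ω : Type*} [MeasurableSpace Ω]

/-- The state probability `P(X(s) = n)`, as a function of the real time `s ≥ 0`. -/
noncomputable def stateProb (P : Measure Ω) (X : ℝ≥0 → Ω → ℕ) (n : ℕ) (s : ℝ) : ℝ :=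
  P.real {ω | X s.toNNReal ω = n}

/-- `X` is a fractional nonlinear birth process of order `ν` with rates `rate 1, rate 2, …`,
started from one individual: a counting process with right-continuous nondecreasing paths that
increase by unit jumps, whose state probabilities `pₙ` are (locally) absolutely continuous and
satisfy `d^ν pₙ / dt^ν = - rate n * pₙ + rate (n-1) * pₙ₋₁`, `n ≥ 1`, with the Caputo derivative.
The initial conditions `pₙ(0) = δ_{n,1}` and the convention `p₀ = 0` are contained in `initial`
and `monotone`. -/
structure IsFractionalBirthProcess (P : Measure Ω) (ν : ℝ) (rate : ℕ → ℝ)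
    (X : ℝ≥0 → Ω → ℕ) : Prop where
  measurable : ∀ s, Measurable (X s)
  initial : ∀ ω, X 0 ω = 1
  monotone : ∀ ω, Monotone fun s => X s ω
  right_continuous : ∀ ω s, ContinuousWithinAt (fun u => X u ω) (Set.Ici s) s
  unit_jumps : ∀ ω s (m : ℕ), 1 ≤ m → m ≤ X s ω → ∃ u ≤ s, X u ω = m
  absolutelyContinuous : ∀ n : ℕ, 1 ≤ n → ∀ b : ℝ, 0 < b →
    AbsolutelyContinuousOnInterval (stateProb P X n) 0 b
  governing : ∀ n : ℕ, 1 ≤ n → ∀ t : ℝ, 0 < t →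
    caputoDeriv ν (stateProb P X n) t
      = -rate n * stateProb P X n t + rate (n - 1) * stateProb P X (n - 1) t

/-- The creation time of webpage number `k`: webpage `0` is present at time `0`, and `S i` is the
time elapsed between the creations of the webpages `i` and `i + 1`. -/
def creationTime (S : ℕ → Ω → ℝ) (k : ℕ) (ω : Ω) : ℝ :=
  ∑ i ∈ Finset.range k, S i ω

/-- The number of webpages present at time `t`. -/
noncomputable def numPages (S : ℕ → Ω → ℝ) (t : ℝ) (ω : Ω) : ℕ :=
  {k : ℕ | creationTime S k ω ≤ t}.ncard

/-- The generalized Yule model. The number of webpages is a Yule process of rate `β` with one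
initial webpage: the holding times are independent, and that with `k + 1` webpages present is
exponential of rate `β * (k + 1)`. Webpage `k` has `X k s` in-links when its age is `s`; the
processes `X k` are independent copies of a fractional nonlinear birth process, and they are
independent of the creation of the webpages. -/
structure IsGeneralizedYuleModel (P : Measure Ω) (β ν : ℝ) (rate : ℕ → ℝ)
    (S : ℕ → Ω → ℝ) (X : ℕ → ℝ≥0 → Ω → ℕ) : Prop where
  measurable_holding : ∀ k, Measurable (S k)
  law_holding : ∀ k : ℕ, P.map (S k) = expMeasure (β * (k + 1))
  indep_holding : iIndepFun S P
  birth : ∀ k, IsFractionalBirthProcess P ν rate (X k)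
  identDistrib : ∀ k, IdentDistrib (fun ω s => X k s ω) (fun ω s => X 0 s ω) P P
  indep_inlinks : iIndepFun (fun k ω s => X k s ω) P
  indep_holding_inlinks : IndepFun (fun ω k => S k ω) (fun ω k s => X k s ω) P

/-- The information on the whole network: all the holding times and all the in-link processes. -/
@[reducible] def networkInfo (S : ℕ → Ω → ℝ) (X : ℕ → ℝ≥0 → Ω → ℕ) : MeasurableSpace Ω :=
  MeasurableSpace.comap (fun ω => ((fun k => S k ω), (fun k s => X k s ω)))
    (inferInstance : MeasurableSpace ((ℕ → ℝ) × (ℕ → ℝ≥0 → ℕ)))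

/-- `J` is the label of a webpage chosen uniformly at random among those present at time `t`:
conditionally on the whole network, `J = k` with probability `1 / numPages S t` for each of the
webpages `k` that are present at time `t`, and with probability `0` for the other ones. -/
structure IsUniformChoice (P : Measure Ω) (S : ℕ → Ω → ℝ) (X : ℕ → ℝ≥0 → Ω → ℕ) (t : ℝ)
    (J : Ω → ℕ) : Prop where
  measurable : Measurable J
  uniform : ∀ (k : ℕ) (A : Set Ω), MeasurableSet[networkInfo S X] A →
    P ({ω | J ω = k} ∩ A)
      = ∫⁻ ω in {ω | creationTime S k ω ≤ t} ∩ A, (numPages S t ω : ℝ≥0∞)⁻¹ ∂P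

/-- The number of in-links, at time `t`, of the webpage with the random label `J`. -/
noncomputable def chosenSize (S : ℕ → Ω → ℝ) (X : ℕ → ℝ≥0 → Ω → ℕ) (t : ℝ) (J : Ω → ℕ)
    (ω : Ω) : ℕ :=
  X (J ω) (t - creationTime S (J ω) ω).toNNReal ω

/-- The probability that the chosen webpage has `n` in-links at time `t`, given that it is one of
the webpages created after time `0`, i.e. one that has a random creation time. -/
noncomputable def condSizeProb (P : Measure Ω) (S : ℕ → Ω → ℝ) (X : ℕ → ℝ≥0 → Ω → ℕ) (t : ℝ)
    (J : Ω → ℕ) (n : ℕ) : ℝ :=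
  (ProbabilityTheory.cond P {ω | J ω ≠ 0}).real {ω | chosenSize S X t J ω = n}

end Model

/-- The `r`-th term of the series `∑ γ(νr+1, βt) / Γ(νr+1) * (-(λ j) / β^ν)^r`. -/
noncomputable def lowerTerm (β ν lam t : ℝ) (j r : ℕ) : ℝ :=
  lowerGamma (ν * r + 1) (β * t) / Real.Gamma (ν * r + 1) * (-(lam * j) / β ^ ν) ^ r

/-- The `r`-th term of the series `∑ Γ(νr+1, βt) / Γ(νr+1) * (-(λ j) / β^ν)^r`. -/
noncomputable def upperTerm (β ν lam t : ℝ) (j r : ℕ) : ℝ :=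
  upperGamma (ν * r + 1) (β * t) / Real.Gamma (ν * r + 1) * (-(lam * j) / β ^ ν) ^ r

end FractionalYule

/-! The proof separates the age of the chosen webpage from the in-link process.

Age. In a Yule process with `m + 1` individuals at time `t`, the sum of `h` over the `m` creation
times has conditional expectation `m` times the mean of `h` under the density `β e^{βs} / (e^{βt} -
1)` on `[0, t]`. This density does not depend on `m`, so the weights `1 / (m + 1)` of the uniform
choice enter only through a common factor `choiceFactor`, which cancels upon conditioning on `J ≠
0`. The age is thus an exponential variable of rate `β` truncated at `t`, and independence of the
in-links gives `q_t(n) = (1 - e^{-βt})⁻¹ ∫₀ᵗ β e^{-βy} pₙ(y) dy` (`condSizeProb_eq`).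

State probabilities. Applying the Riemann–Liouville integral of order `ν` turns the Caputo system
into a Volterra system (`fracIntegral_caputoDeriv`). Iterating it from `0 ≤ pₙ ≤ 1` gives an
expansion in `t^{νr} / Γ(νr + 1)` whose remainder vanishes locally uniformly (`abs_sub_sum_le`);
termwise integration over `[0, t]` produces the lower incomplete Gamma series. The Laplace transform
at `β` instead yields a first-order recursion in `n`, solved by the Gamma quotient with no
restriction on `lam * n` (`laplace_eq`); subtracting the tail over `(t, ∞)` gives the other form of
(i).

For (ii), `γ(a, x) + Γ(a, x) = Γ(a)` makes the upper series a geometric series minus an always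
convergent one, and the alternating sum of the geometric values is the Yule–Simon weight. For (iii),
let `t → ∞`; the initial webpage is chosen with probability `βt e^{-βt} / (1 - e^{-βt})`, which
tends to `0`. -/

namespace FractionalYule

/-! ### Fractional integrals -/

lemma integral_sub_rpow_mul_rpow {a b T : ℝ} (ha : 0 < a) (hb : 0 < b) (hT : 0 < T) :
    ∫ x in (0 : ℝ)..T, (T - x) ^ (a - 1) * x ^ (b - 1)
      = T ^ (a + b - 1) * (Real.Gamma a * Real.Gamma b / Real.Gamma (a + b)) := by
  have h := Complex.betaIntegral_scaled (b : ℂ) (a : ℂ) hT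
  rw [Complex.betaIntegral_eq_Gamma_mul_div _ _ (by simpa) (by simpa)] at h
  have h2 : (∫ x in (0 : ℝ)..T, (x : ℂ) ^ ((b : ℂ) - 1) * ((T : ℂ) - x) ^ ((a : ℂ) - 1))
      = ((∫ x in (0 : ℝ)..T, (T - x) ^ (a - 1) * x ^ (b - 1) : ℝ) : ℂ) := by
    rw [← intervalIntegral.integral_ofReal]
    refine intervalIntegral.integral_congr fun x hx => ?_
    rw [Set.uIcc_of_le hT.le] at hx
    rw [Complex.ofReal_mul, Complex.ofReal_cpow hx.1, Complex.ofReal_cpow (sub_nonneg.2 hx.2)]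
    push_cast
    ring
  rw [h2] at h
  have h3 : (T : ℂ) ^ ((b : ℂ) + a - 1) * (Complex.Gamma b * Complex.Gamma a / Complex.Gamma (b + a))
      = ((T ^ (a + b - 1) * (Real.Gamma a * Real.Gamma b / Real.Gamma (a + b)) : ℝ) : ℂ) := by
    rw [Complex.ofReal_mul, Complex.ofReal_cpow hT.le]
    push_cast
    rw [← Complex.Gamma_ofReal, ← Complex.Gamma_ofReal, ← Complex.Gamma_ofReal]
    push_cast
    rw [add_comm (b : ℂ) a, mul_comm (Complex.Gamma b)]
  rw [h3] at h
  exact_mod_cast h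

/-- A non-integrable function has integral `0` by convention, whereas the Beta value is positive. -/
lemma intervalIntegrable_sub_rpow_mul_rpow {a b T : ℝ} (ha : 0 < a) (hb : 0 < b) (hT : 0 < T) :
    IntervalIntegrable (fun x => (T - x) ^ (a - 1) * x ^ (b - 1)) volume 0 T := by
  by_contra h
  have h2 := intervalIntegral.integral_undef h
  rw [integral_sub_rpow_mul_rpow ha hb hT] at h2
  have := Real.Gamma_pos_of_pos ha
  have := Real.Gamma_pos_of_pos hb
  have := Real.Gamma_pos_of_pos (add_pos ha hb)
  have : 0 < T ^ (a + b - 1) * (Real.Gamma a * Real.Gamma b / Real.Gamma (a + b)) := by positivity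
  exact this.ne' h2

/-- The Riemann–Liouville integral of order `ν`, with base point `0`. -/
noncomputable def fracIntegral (ν : ℝ) (f : ℝ → ℝ) (t : ℝ) : ℝ :=
  (Real.Gamma ν)⁻¹ * ∫ s in (0 : ℝ)..t, (t - s) ^ (ν - 1) * f s

lemma fracIntegral_rpow {ν c t : ℝ} (hν : 0 < ν) (hc : 0 ≤ c) (ht : 0 < t) :
    fracIntegral ν (fun s => s ^ c / Real.Gamma (c + 1)) t
      = t ^ (c + ν) / Real.Gamma (c + ν + 1) := by
  have h := integral_sub_rpow_mul_rpow hν (show 0 < c + 1 by linarith) ht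
  have e : ∀ s : ℝ, (t - s) ^ (ν - 1) * (s ^ c / Real.Gamma (c + 1))
      = (Real.Gamma (c + 1))⁻¹ * ((t - s) ^ (ν - 1) * s ^ (c + 1 - 1)) := by
    intro s; rw [add_sub_cancel_right]; ring
  unfold fracIntegral
  simp_rw [e]
  rw [intervalIntegral.integral_const_mul, h]
  have h1 := (Real.Gamma_pos_of_pos hν).ne'
  have h2 := (Real.Gamma_pos_of_pos (show 0 < c + 1 by linarith)).ne'
  rw [show ν + (c + 1) - 1 = c + ν by ring, show ν + (c + 1) = c + ν + 1 by ring]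
  field_simp

lemma intervalIntegrable_sub_rpow_mul {ν t : ℝ} (hν : 0 < ν) (ht : 0 < t) {f : ℝ → ℝ}
    (hf : ContinuousOn f (Set.uIcc 0 t)) :
    IntervalIntegrable (fun s => (t - s) ^ (ν - 1) * f s) volume 0 t := by
  have h := intervalIntegrable_sub_rpow_mul_rpow hν one_pos ht
  simp only [sub_self, Real.rpow_zero, mul_one] at h
  exact h.mul_continuousOn hf

lemma fracIntegral_sub {ν t : ℝ} (hν : 0 < ν) (ht : 0 < t) {f g : ℝ → ℝ}
    (hf : ContinuousOn f (Set.uIcc 0 t)) (hg : ContinuousOn g (Set.uIcc 0 t)) :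
    fracIntegral ν (fun s => f s - g s) t = fracIntegral ν f t - fracIntegral ν g t := by
  unfold fracIntegral
  rw [← mul_sub, ← intervalIntegral.integral_sub (intervalIntegrable_sub_rpow_mul hν ht hf)
    (intervalIntegrable_sub_rpow_mul hν ht hg)]
  simp_rw [mul_sub]

lemma fracIntegral_const_mul (ν c t : ℝ) (f : ℝ → ℝ) :
    fracIntegral ν (fun s => c * f s) t = c * fracIntegral ν f t := by
  unfold fracIntegral
  simp_rw [mul_left_comm _ c]
  rw [intervalIntegral.integral_const_mul]
  ring

lemma fracIntegral_finset_sum {ι : Type*} {ν t : ℝ} (hν : 0 < ν) (ht : 0 < t) (s : Finset ι)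
    {f : ι → ℝ → ℝ} (hf : ∀ i ∈ s, ContinuousOn (f i) (Set.uIcc 0 t)) :
    fracIntegral ν (fun x => ∑ i ∈ s, f i x) t = ∑ i ∈ s, fracIntegral ν (f i) t := by
  unfold fracIntegral
  simp_rw [Finset.mul_sum]
  rw [intervalIntegral.integral_finsetSum
    fun i hi => intervalIntegrable_sub_rpow_mul hν ht (hf i hi), Finset.mul_sum]

lemma abs_fracIntegral_le {ν t : ℝ} (hν : 0 < ν) (ht : 0 < t) {f g : ℝ → ℝ}
    (hg : ContinuousOn g (Set.uIcc 0 t)) (h : ∀ s ∈ Set.Ioc 0 t, |f s| ≤ g s) :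
    |fracIntegral ν f t| ≤ fracIntegral ν g t := by
  unfold fracIntegral
  have h0 : 0 ≤ (Real.Gamma ν)⁻¹ := inv_nonneg.2 (Real.Gamma_pos_of_pos hν).le
  rw [abs_mul, abs_of_nonneg h0]
  refine mul_le_mul_of_nonneg_left ?_ h0
  rw [← Real.norm_eq_abs]
  refine intervalIntegral.norm_integral_le_of_norm_le ht.le ?_
    (intervalIntegrable_sub_rpow_mul hν ht hg)
  refine Eventually.of_forall fun s hs => ?_
  rw [norm_mul, Real.norm_eq_abs, Real.norm_eq_abs,
    abs_of_nonneg (Real.rpow_nonneg (sub_nonneg.2 hs.2) _)]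
  exact mul_le_mul_of_nonneg_left (h s hs) (Real.rpow_nonneg (sub_nonneg.2 hs.2) _)

lemma integral_abel_kernel {ν s T : ℝ} (hν0 : 0 < ν) (hν1 : ν < 1) (hs : s < T) :
    ∫ t in s..T, (T - t) ^ (ν - 1) * (t - s) ^ (-ν) = Real.Gamma ν * Real.Gamma (1 - ν) := by
  have h := integral_sub_rpow_mul_rpow hν0 (sub_pos.2 hν1) (sub_pos.2 hs)
  have h2 := intervalIntegral.integral_comp_sub_right
    (fun x => (T - s - x) ^ (ν - 1) * x ^ (1 - ν - 1)) s (a := s) (b := T)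
  rw [sub_self, h] at h2
  simp only [add_sub_cancel, sub_self, Real.rpow_zero, Real.Gamma_one, div_one, one_mul] at h2
  rw [← h2]
  congr 1 with t
  rw [show T - s - (t - s) = T - t by ring, show 1 - ν - 1 = -ν by ring]

lemma intervalIntegrable_abel_kernel {ν s T : ℝ} (hν0 : 0 < ν) (hν1 : ν < 1) (hs : s < T) :
    IntervalIntegrable (fun t => (T - t) ^ (ν - 1) * (t - s) ^ (-ν)) volume s T := by
  by_contra h
  have h2 := intervalIntegral.integral_undef h
  rw [integral_abel_kernel hν0 hν1 hs] at h2
  have := Real.Gamma_pos_of_pos hν0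
  have := Real.Gamma_pos_of_pos (sub_pos.2 hν1)
  have : 0 < Real.Gamma ν * Real.Gamma (1 - ν) := by positivity
  exact this.ne' h2

/-- Abel inversion: after Fubini on the triangle `0 < s < t ≤ T`, the inner integral of the kernel
is the Beta value `Γ(ν) Γ(1 - ν)` for every `s`, and this cancels the two normalizations. -/
lemma fracIntegral_abel {ν T : ℝ} (hν0 : 0 < ν) (hν1 : ν < 1) (hT : 0 < T) {f : ℝ → ℝ}
    (hf : IntervalIntegrable f volume 0 T) :
    fracIntegral ν (fun t => (Real.Gamma (1 - ν))⁻¹ * ∫ s in (0 : ℝ)..t, f s / (t - s) ^ ν) T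
      = ∫ s in (0 : ℝ)..T, f s := by
  set μ : Measure ℝ := volume.restrict (Set.Ioc 0 T)
  set F : ℝ → ℝ → ℝ := fun s t =>
    (Set.Ioc s T).indicator (fun t => (T - t) ^ (ν - 1) * (t - s) ^ (-ν)) t * f s with hF
  have hfi : Integrable f μ := (intervalIntegrable_iff_integrableOn_Ioc_of_le hT.le).1 hf
  set B := Real.Gamma ν * Real.Gamma (1 - ν) with hB
  have hB0 : 0 < B := mul_pos (Real.Gamma_pos_of_pos hν0) (Real.Gamma_pos_of_pos (sub_pos.2 hν1))
  have hk0 : ∀ s t, 0 ≤ (Set.Ioc s T).indicator (fun t => (T - t) ^ (ν - 1) * (t - s) ^ (-ν)) t := by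
    intro s t
    refine Set.indicator_nonneg (fun t ht => ?_) t
    exact mul_nonneg (Real.rpow_nonneg (sub_nonneg.2 ht.2) _)
      (Real.rpow_nonneg (sub_nonneg.2 ht.1.le) _)
  have hμI : ∀ s, 0 < s → μ.restrict (Set.Ioc s T) = volume.restrict (Set.Ioc s T) := by
    intro s hs
    rw [Measure.restrict_restrict measurableSet_Ioc, Set.inter_eq_left.2]
    exact Set.Ioc_subset_Ioc_left hs.le
  have hkint : ∀ s, 0 < s → s < T →
      ∫ t, (Set.Ioc s T).indicator (fun t => (T - t) ^ (ν - 1) * (t - s) ^ (-ν)) t ∂μ = B := by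
    intro s hs hsT
    rw [integral_indicator measurableSet_Ioc, hμI s hs, ← intervalIntegral.integral_of_le hsT.le,
      integral_abel_kernel hν0 hν1 hsT]
  have hki : ∀ s, 0 < s → s < T →
      Integrable ((Set.Ioc s T).indicator (fun t => (T - t) ^ (ν - 1) * (t - s) ^ (-ν))) μ := by
    intro s hs hsT
    rw [integrable_indicator_iff measurableSet_Ioc, IntegrableOn, hμI s hs]
    exact (intervalIntegrable_iff_integrableOn_Ioc_of_le hsT.le).1
      (intervalIntegrable_abel_kernel hν0 hν1 hsT)
  have hae : ∀ᵐ s ∂μ, 0 < s ∧ s < T := by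
    have h1 : ∀ᵐ s ∂μ, s ∈ Set.Ioc 0 T := ae_restrict_mem measurableSet_Ioc
    have h2 : ∀ᵐ s ∂μ, s ≠ T := ae_restrict_of_ae (Measure.ae_ne volume T)
    filter_upwards [h1, h2] with s h1 h2 using ⟨h1.1, lt_of_le_of_ne h1.2 h2⟩
  have hmeas : AEStronglyMeasurable (Function.uncurry F) (μ.prod μ) := by
    have h1 : Measurable fun z : ℝ × ℝ =>
        (Set.Ioc z.1 T).indicator (fun t => (T - t) ^ (ν - 1) * (t - z.1) ^ (-ν)) z.2 := by
      have : (fun z : ℝ × ℝ =>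
          (Set.Ioc z.1 T).indicator (fun t => (T - t) ^ (ν - 1) * (t - z.1) ^ (-ν)) z.2)
          = {z : ℝ × ℝ | z.1 < z.2 ∧ z.2 ≤ T}.indicator
            fun z => (T - z.2) ^ (ν - 1) * (z.2 - z.1) ^ (-ν) := by
        ext z
        simp only [Set.indicator, Set.mem_Ioc, Set.mem_ofPred_eq]
      rw [this]
      refine Measurable.indicator (by fun_prop) ?_
      exact (measurableSet_lt measurable_fst measurable_snd).inter
        (measurableSet_le measurable_snd measurable_const)
    exact h1.aestronglyMeasurable.mul hfi.aestronglyMeasurable.comp_fst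
  -- The kernel is nonnegative with total mass `B` in `t`, so the norms integrate to `B` times the
  -- `L¹` norm of `f`.
  have hFi : Integrable (Function.uncurry F) (μ.prod μ) := by
    rw [integrable_prod_iff hmeas]
    refine ⟨?_, ?_⟩
    · filter_upwards [hae] with s hs
      exact (hki s hs.1 hs.2).mul_const (f s)
    · refine (hfi.norm.const_mul B).congr ?_
      filter_upwards [hae] with s hs
      simp only [Function.uncurry, hF, norm_mul]
      rw [integral_mul_const]
      congr 1
      rw [← hkint s hs.1 hs.2]
      congr 1 with t
      exact (Real.norm_of_nonneg (hk0 s t)).symm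
  have hswap := integral_integral_swap hFi
  have hL : ∫ s, ∫ t, F s t ∂μ ∂μ = B * ∫ s in (0 : ℝ)..T, f s := by
    rw [intervalIntegral.integral_of_le hT.le, ← integral_const_mul]
    refine integral_congr_ae ?_
    filter_upwards [hae] with s hs
    simp only [hF]
    rw [integral_mul_const, hkint s hs.1 hs.2]
  have hR : ∫ t, ∫ s, F s t ∂μ ∂μ
      = ∫ t in (0 : ℝ)..T, (T - t) ^ (ν - 1) * ∫ s in (0 : ℝ)..t, f s / (t - s) ^ ν := by
    rw [intervalIntegral.integral_of_le hT.le]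
    refine integral_congr_ae ?_
    filter_upwards [hae] with t ht
    have h1 : ∀ s, F s t = (Set.Iio t).indicator
        (fun s => (T - t) ^ (ν - 1) * (f s / (t - s) ^ ν)) s := by
      intro s
      simp only [hF, Set.indicator, Set.mem_Ioc, Set.mem_Iio, ht.2.le, and_true]
      split_ifs with h
      · rw [Real.rpow_neg (sub_nonneg.2 h.le)]
        ring
      · simp
    simp_rw [h1]
    rw [integral_indicator measurableSet_Iio, Measure.restrict_restrict measurableSet_Iio,
      integral_const_mul, intervalIntegral.integral_of_le ht.1.le, integral_Ioc_eq_integral_Ioo]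
    congr 3
    ext s
    simp only [Set.mem_inter_iff, Set.mem_Iio, Set.mem_Ioc, Set.mem_Ioo]
    constructor
    · rintro ⟨h1, h2, -⟩; exact ⟨h2, h1⟩
    · rintro ⟨h1, h2⟩; exact ⟨h2, h1, (h2.trans ht.2).le⟩
  unfold fracIntegral
  have e : ∀ t, (T - t) ^ (ν - 1) * ((Real.Gamma (1 - ν))⁻¹ * ∫ s in (0 : ℝ)..t, f s / (t - s) ^ ν)
    = (Real.Gamma (1 - ν))⁻¹ * ((T - t) ^ (ν - 1) * ∫ s in (0 : ℝ)..t, f s / (t - s) ^ ν) :=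
    fun t => by ring
  simp_rw [e]
  rw [intervalIntegral.integral_const_mul, ← hR, ← hswap, hL, hB]
  have h1 := (Real.Gamma_pos_of_pos hν0).ne'
  have h2 := (Real.Gamma_pos_of_pos (sub_pos.2 hν1)).ne'
  field_simp

/-- Absolute continuity is what makes the integral of `deriv f` recover the increment of `f`;
differentiability almost everywhere would not suffice. -/
lemma fracIntegral_caputoDeriv {ν T : ℝ} (hν0 : 0 < ν) (hν1 : ν < 1) (hT : 0 < T) {f : ℝ → ℝ}
    (hf : AbsolutelyContinuousOnInterval f 0 T) :
    fracIntegral ν (caputoDeriv ν f) T = f T - f 0 := by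
  rw [← hf.integral_deriv_eq_sub]
  exact fracIntegral_abel hν0 hν1 hT hf.intervalIntegrable_deriv

/-! ### Mittag-Leffler type series -/

/-- Keep only the part of the Gamma integral beyond `R`, where the power is at least `R ^ (s - 1)`.
With `R` free, this shows that `Γ(νr + 1)` outgrows every geometric sequence. -/
lemma rpow_mul_exp_neg_le_Gamma {R s : ℝ} (hR : 0 < R) (hs : 1 ≤ s) :
    R ^ (s - 1) * Real.exp (-R) ≤ Real.Gamma s := by
  rw [Real.Gamma_eq_integral (by linarith)]
  have hi := Real.GammaIntegral_convergent (show 0 < s by linarith)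
  calc R ^ (s - 1) * Real.exp (-R) = ∫ x in Set.Ioi R, Real.exp (-x) * R ^ (s - 1) := by
        rw [integral_mul_const, integral_exp_neg_Ioi, mul_comm]
    _ ≤ ∫ x in Set.Ioi R, Real.exp (-x) * x ^ (s - 1) := by
        refine setIntegral_mono_on ?_ (hi.mono_set (Set.Ioi_subset_Ioi hR.le)) measurableSet_Ioi ?_
        · exact (integrableOn_exp_neg_Ioi R).mul_const _
        · intro x hx
          exact mul_le_mul_of_nonneg_left
            (Real.rpow_le_rpow hR.le (le_of_lt hx) (by linarith)) (Real.exp_pos _).le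
    _ ≤ ∫ x in Set.Ioi 0, Real.exp (-x) * x ^ (s - 1) := by
        refine setIntegral_mono_set hi ?_ (Set.Ioi_subset_Ioi hR.le).eventuallyLE
        refine (ae_restrict_mem measurableSet_Ioi).mono fun x hx => ?_
        exact mul_nonneg (Real.exp_pos _).le (Real.rpow_nonneg (le_of_lt hx) _)

lemma Gamma_mul_natCast_add_one_pos {ν : ℝ} (hν : 0 < ν) (r : ℕ) : 0 < Real.Gamma (ν * r + 1) :=
  Real.Gamma_pos_of_pos (by positivity)

lemma summable_pow_div_Gamma {ν : ℝ} (hν : 0 < ν) (z : ℝ) :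
    Summable fun r : ℕ => z ^ r / Real.Gamma (ν * r + 1) := by
  -- `R` is chosen with `R ^ ν = 2 (|z| + 1)`, so that the lower bound on the Gamma function leaves
  -- a geometric series of ratio `1 / 2`.
  set R : ℝ := (2 * (|z| + 1)) ^ ν⁻¹ with hR
  have h0 : 0 < 2 * (|z| + 1) := by positivity
  have hR0 : 0 < R := Real.rpow_pos_of_pos h0 _
  have hRν : R ^ ν = 2 * (|z| + 1) := Real.rpow_inv_rpow h0.le hν.ne'
  have hs : Summable fun r : ℕ => Real.exp R * (1 / 2 : ℝ) ^ r :=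
    (summable_geometric_of_lt_one (by norm_num) (by norm_num)).mul_left _
  refine Summable.of_norm_bounded hs fun r => ?_
  have hG := Gamma_mul_natCast_add_one_pos hν r
  rw [norm_div, norm_pow, Real.norm_eq_abs, Real.norm_of_nonneg hG.le, div_le_iff₀ hG]
  have h1 := rpow_mul_exp_neg_le_Gamma (s := ν * r + 1) hR0 (by
    have : 0 ≤ ν * r := by positivity
    linarith)
  rw [add_sub_cancel_right, Real.rpow_mul hR0.le, hRν, Real.rpow_natCast] at h1
  calc |z| ^ r ≤ (|z| + 1) ^ r := pow_le_pow_left₀ (abs_nonneg z) (by linarith) r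
    _ = Real.exp R * (1 / 2) ^ r * ((2 * (|z| + 1)) ^ r * Real.exp (-R)) := by
        rw [Real.exp_neg, mul_pow, one_div, inv_pow]
        have := Real.exp_pos R
        field_simp
    _ ≤ _ := mul_le_mul_of_nonneg_left h1 (by positivity)

/-- The function `t ^ (ν r) / Γ(ν r + 1)`. -/
noncomputable def powGamma (ν : ℝ) (r : ℕ) (t : ℝ) : ℝ := t ^ (ν * r) / Real.Gamma (ν * r + 1)

lemma powGamma_zero (ν t : ℝ) : powGamma ν 0 t = 1 := by simp [powGamma]

lemma powGamma_nonneg {ν t : ℝ} (hν : 0 < ν) (ht : 0 ≤ t) (r : ℕ) : 0 ≤ powGamma ν r t :=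
  div_nonneg (Real.rpow_nonneg ht _) (Gamma_mul_natCast_add_one_pos hν r).le

lemma powGamma_mono {ν s t : ℝ} (hν : 0 < ν) (hs : 0 ≤ s) (hst : s ≤ t) (r : ℕ) :
    powGamma ν r s ≤ powGamma ν r t :=
  div_le_div_of_nonneg_right (Real.rpow_le_rpow hs hst (by positivity))
    (Gamma_mul_natCast_add_one_pos hν r).le

lemma continuous_powGamma {ν : ℝ} (hν : 0 < ν) (r : ℕ) : Continuous (powGamma ν r) :=
  (Real.continuous_rpow_const (by positivity)).div_const _

lemma fracIntegral_powGamma {ν t : ℝ} (hν : 0 < ν) (ht : 0 < t) (r : ℕ) :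
    fracIntegral ν (powGamma ν r) t = powGamma ν (r + 1) t := by
  have h := fracIntegral_rpow hν (show 0 ≤ ν * r by positivity) ht
  unfold powGamma
  rw [h]
  push_cast
  rw [mul_add, mul_one]

lemma tendsto_pow_mul_powGamma {ν t : ℝ} (hν : 0 < ν) (ht : 0 ≤ t) (c : ℝ) :
    Tendsto (fun k : ℕ => c ^ k * powGamma ν k t) atTop (𝓝 0) := by
  have h := (summable_pow_div_Gamma hν (c * t ^ ν)).tendsto_atTop_zero
  refine h.congr fun k => ?_
  rw [powGamma, Real.rpow_mul ht, Real.rpow_natCast, mul_pow, mul_div_assoc]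

/-! ### The fractional linear birth equations -/

/-- The functions `p n` are bounded, continuous and satisfy the integrated form of the fractional
equations of the linear birth process of rate `lam`, started from one individual. -/
structure IsLinearBirthSolution (ν lam : ℝ) (p : ℕ → ℝ → ℝ) : Prop where
  continuous : ∀ n, Continuous (p n)
  nonneg : ∀ n t, 0 ≤ p n t
  le_one : ∀ n t, p n t ≤ 1
  zero : ∀ t, p 0 t = 0
  equation : ∀ n : ℕ, ∀ t : ℝ, 0 < t → p (n + 1) t = (if n = 0 then 1 else 0)
    + fracIntegral ν (fun s => -(lam * (n + 1)) * p (n + 1) s + lam * n * p n s) t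

/-- The coefficient of `t ^ (ν r) / Γ(ν r + 1)` in the `n`-th state probability of the fractional
linear birth process. -/
noncomputable def birthCoeff (lam : ℝ) (n r : ℕ) : ℝ :=
  ∑ j ∈ Finset.range n, ((n - 1).choose j : ℝ) * (-1) ^ j * (-(lam * (j + 1))) ^ r

lemma birthCoeff_zero_left (lam : ℝ) (r : ℕ) : birthCoeff lam 0 r = 0 := by simp [birthCoeff]

lemma birthCoeff_succ_zero (lam : ℝ) (n : ℕ) :
    birthCoeff lam (n + 1) 0 = if n = 0 then 1 else 0 := by
  have h := Int.alternating_sum_range_choose (n := n)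
  have h2 : ((∑ m ∈ Finset.range (n + 1), (-1) ^ m * (n.choose m : ℤ) : ℤ) : ℝ)
      = ((if n = 0 then 1 else 0 : ℤ) : ℝ) := by rw [h]
  push_cast at h2
  rw [← h2]
  refine Finset.sum_congr rfl fun j _ => ?_
  simp [mul_comm]

/-- Matching powers in the Volterra equation requires this recursion. It holds separately for each
index `j`, through `C(n, j) (n + 1) = C(n + 1, j) (n + 1 - j)`. -/
lemma birthCoeff_succ_succ (lam : ℝ) (n r : ℕ) :
    birthCoeff lam (n + 1) (r + 1)
      = -(lam * (n + 1)) * birthCoeff lam (n + 1) r + lam * n * birthCoeff lam n r := by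
  cases n with
  | zero => simp [birthCoeff, pow_succ, mul_comm]
  | succ n =>
    -- The sum is extended by one term, which is zero because `C(n, n + 1) = 0`, so that all three
    -- sums run over the same range.
    have h : birthCoeff lam (n + 1) r = ∑ j ∈ Finset.range (n + 1 + 1),
        (n.choose j : ℝ) * (-1) ^ j * (-(lam * (j + 1))) ^ r := by
      rw [Finset.sum_range_succ, Nat.choose_succ_self]
      simp [birthCoeff]
    rw [h]
    unfold birthCoeff
    rw [Finset.mul_sum, Finset.mul_sum, ← Finset.sum_add_distrib]
    refine Finset.sum_congr rfl fun j hj => ?_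
    have hjn : j ≤ n + 1 := by
      have := Finset.mem_range.1 hj
      omega
    have h2 := Nat.choose_mul_succ_eq n j
    have h3 : (n.choose j : ℝ) * (n + 1) = ((n + 1).choose j : ℝ) * (n + 1 - j) := by
      have := congrArg (Nat.cast (R := ℝ)) h2
      rw [Nat.cast_mul, Nat.cast_mul, Nat.cast_sub hjn] at this
      push_cast at this
      exact this
    rw [pow_succ, Nat.add_sub_cancel]
    push_cast
    linear_combination (-(lam * (-1) ^ j * (-(lam * (j + 1))) ^ r)) * h3

namespace IsLinearBirthSolution

variable {ν lam : ℝ} {p : ℕ → ℝ → ℝ}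

/-- Picard iteration. The remainder of order `k + 1` is the fractional integral of the linear system
applied to the remainders of order `k`. Each iteration costs a factor of at most `lam * (n + 1) +
lam * n ≤ 2 * lam * (n + 1)` and raises `powGamma ν k` to `powGamma ν (k + 1)`. The start `k = 0` is
`0 ≤ p ≤ 1`, so uniqueness needs no separate argument. -/
lemma abs_sub_sum_le (hp : IsLinearBirthSolution ν lam p) (hν : 0 < ν) (hlam : 0 < lam) (k : ℕ) :
    ∀ (n : ℕ) (t : ℝ), 0 < t →
      |p n t - ∑ r ∈ Finset.range k, birthCoeff lam n r * powGamma ν r t|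
        ≤ (2 * lam * n) ^ k * powGamma ν k t := by
  induction k with
  | zero =>
    intro n t ht
    simp only [Finset.range_zero, Finset.sum_empty, sub_zero, pow_zero, one_mul, powGamma_zero]
    rw [abs_of_nonneg (hp.nonneg n t)]
    exact hp.le_one n t
  | succ k ih =>
    intro n t ht
    cases n with
    | zero => simp [hp.zero, birthCoeff_zero_left]
    | succ n =>
      set D : ℕ → ℝ → ℝ := fun m s =>
        p m s - ∑ r ∈ Finset.range k, birthCoeff lam m r * powGamma ν r s with hD
      have hsc : ∀ m, Continuous fun s =>
          ∑ r ∈ Finset.range k, birthCoeff lam m r * powGamma ν r s := fun m =>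
        continuous_finsetSum _ fun r _ => (continuous_powGamma hν r).const_mul _
      have h1 : ∑ r ∈ Finset.range (k + 1), birthCoeff lam (n + 1) r * powGamma ν r t
          -- The term `r = 0` is the initial value; each later term is the fractional integral of
          -- the power one step lower.
          = (if n = 0 then 1 else 0) + fracIntegral ν (fun s =>
            ∑ r ∈ Finset.range k, birthCoeff lam (n + 1) (r + 1) * powGamma ν r s) t := by
        rw [Finset.sum_range_succ', birthCoeff_succ_zero, powGamma_zero, mul_one, add_comm,
          fracIntegral_finset_sum hν ht _
            fun r _ => ((continuous_powGamma hν r).const_mul _).continuousOn]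
        congr 1
        refine Finset.sum_congr rfl fun r _ => ?_
        rw [fracIntegral_const_mul, fracIntegral_powGamma hν ht]
      have h2 : p (n + 1) t - ∑ r ∈ Finset.range (k + 1), birthCoeff lam (n + 1) r * powGamma ν r t
          = fracIntegral ν (fun s => -(lam * (n + 1)) * D (n + 1) s + lam * n * D n s) t := by
        rw [h1, hp.equation n t ht, add_sub_add_left_eq_sub, ← fracIntegral_sub hν ht]
        · congr 1
          ext s
          simp only [hD, birthCoeff_succ_succ, add_mul, Finset.sum_add_distrib, mul_assoc,
            ← Finset.mul_sum]
          ring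
        · exact (((hp.continuous _).const_mul _).add ((hp.continuous _).const_mul _)).continuousOn
        · exact (continuous_finsetSum _ fun r _ =>
            (continuous_powGamma hν r).const_mul _).continuousOn
      rw [h2]
      have h3 : (2 * lam * (n + 1 : ℕ)) ^ (k + 1) * powGamma ν (k + 1) t
          = fracIntegral ν (fun s => (2 * lam * (n + 1 : ℕ)) ^ (k + 1) * powGamma ν k s) t := by
        rw [fracIntegral_const_mul, fracIntegral_powGamma hν ht]
      rw [h3]
      refine abs_fracIntegral_le hν ht ((continuous_powGamma hν k).const_mul _).continuousOn ?_
      intro s hs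
      have i1 := ih (n + 1) s hs.1
      have i2 := ih n s hs.1
      have hφ := powGamma_nonneg hν hs.1.le k
      have i3 : (2 * lam * n) ^ k * powGamma ν k s ≤ (2 * lam * (n + 1 : ℕ)) ^ k * powGamma ν k s := by
        refine mul_le_mul_of_nonneg_right (pow_le_pow_left₀ (by positivity) ?_ k) hφ
        push_cast
        nlinarith
      calc |-(lam * (n + 1)) * D (n + 1) s + lam * n * D n s|
          ≤ lam * (n + 1) * |D (n + 1) s| + lam * n * |D n s| := by
            refine (abs_add_le _ _).trans (le_of_eq ?_)
            rw [abs_mul, abs_mul, abs_neg, abs_of_nonneg (show 0 ≤ lam * ((n : ℝ) + 1) by positivity),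
              abs_of_nonneg (show 0 ≤ lam * (n : ℝ) by positivity)]
        _ ≤ lam * (n + 1) * ((2 * lam * (n + 1 : ℕ)) ^ k * powGamma ν k s)
            + lam * (n + 1) * ((2 * lam * (n + 1 : ℕ)) ^ k * powGamma ν k s) := by
            refine add_le_add (mul_le_mul_of_nonneg_left i1 (by positivity)) ?_
            refine mul_le_mul ?_ (i2.trans i3) (abs_nonneg _) (by positivity)
            nlinarith
        _ = _ := by push_cast; ring

end IsLinearBirthSolution

/-! ### Incomplete Gamma functions -/

section IncompleteGamma

variable {β ν lam t : ℝ}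

lemma integral_exp_mul_powGamma (hβ : 0 < β) (hν : 0 < ν) (ht : 0 < t) (r : ℕ) :
    ∫ y in (0 : ℝ)..t, β * Real.exp (-β * y) * powGamma ν r y
      = lowerGamma (ν * r + 1) (β * t) / Real.Gamma (ν * r + 1) / (β ^ ν) ^ r := by
  have h := intervalIntegral.integral_comp_mul_left
    (fun u => u ^ (ν * r) * Real.exp (-u)) hβ.ne' (a := 0) (b := t)
  rw [mul_zero, smul_eq_mul] at h
  unfold lowerGamma
  simp only [add_sub_cancel_right]
  have h2 := (eq_inv_mul_iff_mul_eq₀ hβ.ne').1 h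
  rw [← h2, div_div, eq_div_iff (by have := Gamma_mul_natCast_add_one_pos hν r; positivity),
    ← intervalIntegral.integral_const_mul, ← intervalIntegral.integral_mul_const]
  refine intervalIntegral.integral_congr fun y hy => ?_
  rw [Set.uIcc_of_le ht.le] at hy
  have hG := (Gamma_mul_natCast_add_one_pos hν r).ne'
  simp only [powGamma]
  rw [Real.mul_rpow hβ.le hy.1, Real.rpow_mul hβ.le, Real.rpow_natCast, neg_mul]
  field_simp

lemma lowerTerm_eq (hβ : 0 < β) (hν : 0 < ν) (ht : 0 < t) (j r : ℕ) :
    lowerTerm β ν lam t j r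
      = (-(lam * j)) ^ r * ∫ y in (0 : ℝ)..t, β * Real.exp (-β * y) * powGamma ν r y := by
  rw [integral_exp_mul_powGamma hβ hν ht, lowerTerm, div_pow]
  ring

lemma abs_integral_exp_mul_le (hβ : 0 < β) (ht : 0 < t) {f : ℝ → ℝ} {M : ℝ}
    (hf : ∀ y ∈ Set.Ioc 0 t, |f y| ≤ M) :
    |∫ y in (0 : ℝ)..t, β * Real.exp (-β * y) * f y| ≤ β * M * t := by
  have h := intervalIntegral.norm_integral_le_of_norm_le_const (a := (0 : ℝ)) (b := t)
    (f := fun y => β * Real.exp (-β * y) * f y) (C := β * M) ?_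
  · rwa [sub_zero, abs_of_pos ht, Real.norm_eq_abs] at h
  · intro y hy
    rw [Set.uIoc_of_le ht.le] at hy
    have h1 : Real.exp (-β * y) ≤ 1 := Real.exp_le_one_iff.2 (by nlinarith [hy.1])
    rw [norm_mul, Real.norm_eq_abs, Real.norm_eq_abs, abs_mul, abs_of_pos hβ, Real.abs_exp]
    refine mul_le_mul ?_ (hf y hy) (abs_nonneg _) hβ.le
    exact mul_le_of_le_one_right hβ.le h1

lemma summable_lowerTerm (hβ : 0 < β) (hν : 0 < ν) (ht : 0 < t) (j : ℕ) :
    Summable (lowerTerm β ν lam t j) := by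
  have hs := ((summable_pow_div_Gamma hν (|lam * j| * t ^ ν)).mul_left (β * t))
  refine Summable.of_norm_bounded hs fun r => ?_
  rw [lowerTerm_eq hβ hν ht, norm_mul, norm_pow, norm_neg, Real.norm_eq_abs, Real.norm_eq_abs]
  have h := abs_integral_exp_mul_le hβ ht (f := powGamma ν r) (M := powGamma ν r t) ?_
  · refine (mul_le_mul_of_nonneg_left h (by positivity)).trans (le_of_eq ?_)
    rw [powGamma, Real.rpow_mul ht.le, Real.rpow_natCast, mul_pow]
    ring
  · intro y hy
    rw [abs_of_nonneg (powGamma_nonneg hν hy.1.le r)]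
    exact powGamma_mono hν hy.1.le hy.2 r

lemma lowerGamma_add_upperGamma {a x : ℝ} (ha : 0 < a) (hx : 0 ≤ x) :
    lowerGamma a x + upperGamma a x = Real.Gamma a := by
  have hi : IntegrableOn (fun u => u ^ (a - 1) * Real.exp (-u)) (Set.Ioi 0) := by
    simpa only [mul_comm] using Real.GammaIntegral_convergent ha
  rw [Real.Gamma_eq_integral ha, lowerGamma, upperGamma, intervalIntegral.integral_of_le hx,
    ← setIntegral_union (Set.Ioc_disjoint_Ioi le_rfl) measurableSet_Ioi
      (hi.mono_set Set.Ioc_subset_Ioi_self) (hi.mono_set (Set.Ioi_subset_Ioi hx)),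
    Set.Ioc_union_Ioi_eq_Ioi hx]
  simp_rw [mul_comm]

lemma upperTerm_eq (hβ : 0 < β) (hν : 0 < ν) (ht : 0 < t) (j r : ℕ) :
    upperTerm β ν lam t j r = (-(lam * j) / β ^ ν) ^ r - lowerTerm β ν lam t j r := by
  have h := lowerGamma_add_upperGamma (a := ν * r + 1) (x := β * t) (by positivity) (by positivity)
  have hG := (Gamma_mul_natCast_add_one_pos hν r).ne'
  rw [upperTerm, lowerTerm, eq_sub_iff_add_eq'.2 h, sub_div, div_self hG]
  ring

lemma abs_neg_mul_div_lt_one_iff (hβ : 0 < β) (hlam : 0 < lam) (j : ℕ) :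
    |-(lam * j) / β ^ ν| < 1 ↔ lam * j < β ^ ν := by
  have h := Real.rpow_pos_of_pos hβ ν
  rw [abs_div, abs_neg, abs_of_pos h, abs_of_nonneg (by positivity), div_lt_one h]

/-- The upper and lower terms add up to a geometric term, and the lower series always converges. For
real series summability is absolute, so this is the criterion in (ii). -/
lemma summable_upperTerm_iff (hβ : 0 < β) (hν : 0 < ν) (hlam : 0 < lam) (ht : 0 < t) (j : ℕ) :
    Summable (upperTerm β ν lam t j) ↔ lam * j < β ^ ν := by
  have hl := summable_lowerTerm (lam := lam) hβ hν ht j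
  rw [← abs_neg_mul_div_lt_one_iff hβ hlam, ← Real.norm_eq_abs,
    ← summable_geometric_iff_norm_lt_one]
  constructor
  · intro h
    refine (h.add hl).congr fun r => ?_
    rw [upperTerm_eq hβ hν ht, sub_add_cancel]
  · intro h
    exact (h.sub hl).congr fun r => (upperTerm_eq hβ hν ht j r).symm

lemma tsum_upperTerm (hβ : 0 < β) (hν : 0 < ν) (hlam : 0 < lam) (ht : 0 < t) {j : ℕ}
    (hj : lam * j < β ^ ν) :
    ∑' r, upperTerm β ν lam t j r
      = β ^ ν / lam / (β ^ ν / lam + j) - ∑' r, lowerTerm β ν lam t j r := by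
  have hx := (abs_neg_mul_div_lt_one_iff hβ hlam j).2 hj
  have h := Real.rpow_pos_of_pos hβ ν
  simp_rw [upperTerm_eq hβ hν ht]
  rw [(summable_geometric_of_abs_lt_one hx).tsum_sub (summable_lowerTerm hβ hν ht j),
    tsum_geometric_of_abs_lt_one hx]
  congr 1
  have h1 : β ^ ν + lam * j ≠ 0 := by positivity
  have h2 : 1 - -(lam * j) / β ^ ν ≠ 0 := by
    rw [neg_div, sub_neg_eq_add]
    positivity
  have h3 : β ^ ν / lam + j ≠ 0 := by positivity
  rw [inv_eq_one_div, div_eq_div_iff h2 h3]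
  field_simp
  ring

end IncompleteGamma

namespace IsLinearBirthSolution

variable {β ν lam : ℝ} {p : ℕ → ℝ → ℝ}

/-- The partial sums `S k` are the integrals of the Picard partial sums. The remainder bound is
increasing in `y`, so its value at `t` controls the whole interval. -/
lemma integral_exp_mul_eq (hp : IsLinearBirthSolution ν lam p) (hβ : 0 < β) (hν : 0 < ν)
    (hlam : 0 < lam) {t : ℝ} (ht : 0 < t) (n : ℕ) :
    ∫ y in (0 : ℝ)..t, β * Real.exp (-β * y) * p n y
      = ∑ j ∈ Finset.range n, ((n - 1).choose j : ℝ) * (-1) ^ j *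
          ∑' r, lowerTerm β ν lam t (j + 1) r := by
  set S : ℕ → ℝ := fun k => ∑ j ∈ Finset.range n, ((n - 1).choose j : ℝ) * (-1) ^ j *
          ∑ r ∈ Finset.range k, lowerTerm β ν lam t (j + 1) r with hS
  have h1 : Tendsto S atTop (𝓝 (∑ j ∈ Finset.range n, ((n - 1).choose j : ℝ) * (-1) ^ j *
          ∑' r, lowerTerm β ν lam t (j + 1) r)) :=
    tendsto_finsetSum _ fun j _ =>
      ((summable_lowerTerm hβ hν ht (j + 1)).hasSum.tendsto_sum_nat).const_mul _
  have hce : Continuous fun y => β * Real.exp (-β * y) := by fun_prop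
  have h2 : ∀ k, S k = ∫ y in (0 : ℝ)..t, β * Real.exp (-β * y) *
      ∑ r ∈ Finset.range k, birthCoeff lam n r * powGamma ν r y := by
    intro k
    simp_rw [Finset.mul_sum]
    rw [intervalIntegral.integral_finsetSum (f := fun r y =>
        β * Real.exp (-β * y) * (birthCoeff lam n r * powGamma ν r y)) fun r _ =>
      (hce.mul ((continuous_powGamma hν r).const_mul _)).intervalIntegrable _ _]
    simp_rw [mul_left_comm _ (birthCoeff lam n _), intervalIntegral.integral_const_mul, hS,
      Finset.mul_sum]
    rw [Finset.sum_comm]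
    refine Finset.sum_congr rfl fun r _ => ?_
    rw [birthCoeff, Finset.sum_mul]
    refine Finset.sum_congr rfl fun j _ => ?_
    rw [lowerTerm_eq hβ hν ht]
    push_cast
    ring
  have h3 : Tendsto S atTop (𝓝 (∫ y in (0 : ℝ)..t, β * Real.exp (-β * y) * p n y)) := by
    rw [tendsto_iff_dist_tendsto_zero]
    have hlim : Tendsto (fun k : ℕ => β * ((2 * lam * n) ^ k * powGamma ν k t) * t) atTop (𝓝 0) := by
      simpa using ((tendsto_pow_mul_powGamma hν ht.le (2 * lam * n)).const_mul β).mul_const t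
    refine squeeze_zero (fun _ => dist_nonneg) (fun k => ?_) hlim
    have hsc : Continuous fun s =>
        ∑ r ∈ Finset.range k, birthCoeff lam n r * powGamma ν r s :=
      continuous_finsetSum _ fun r _ => (continuous_powGamma hν r).const_mul _
    rw [dist_comm, Real.dist_eq, h2, ← intervalIntegral.integral_sub
      (f := fun y => β * Real.exp (-β * y) * p n y)
      (g := fun y => β * Real.exp (-β * y) *
        ∑ r ∈ Finset.range k, birthCoeff lam n r * powGamma ν r y)
      ((hce.mul (hp.continuous n)).intervalIntegrable _ _)
      ((hce.mul hsc).intervalIntegrable _ _)]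
    simp_rw [← mul_sub]
    refine abs_integral_exp_mul_le hβ ht fun y hy => ?_
    refine (hp.abs_sub_sum_le hν hlam k n y hy.1).trans ?_
    exact mul_le_mul_of_nonneg_left (powGamma_mono hν hy.1.le hy.2 k) (by positivity)
  exact tendsto_nhds_unique h3 h1

lemma integrableOn_exp_mul (hp : IsLinearBirthSolution ν lam p) (hβ : 0 < β) (n : ℕ) (a : ℝ) :
    IntegrableOn (fun y => Real.exp (-β * y) * p n y) (Set.Ioi a) := by
  refine Integrable.mono' (integrableOn_exp_mul_Ioi (neg_neg_of_pos hβ) a)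
    ((by fun_prop : Continuous fun y => Real.exp (-β * y)).mul (hp.continuous n)).aestronglyMeasurable
    (Eventually.of_forall fun y => ?_)
  rw [Real.norm_of_nonneg (mul_nonneg (Real.exp_pos _).le (hp.nonneg n y))]
  exact mul_le_of_le_one_right (Real.exp_pos _).le (hp.le_one n y)

/-- Since `e^{-βx} = e^{-βs} e^{-β(x - s)}`, the weighted fractional integral is a convolution on
the half-line of two integrable functions, and its integral factorizes; the kernel contributes `Γ(ν)
β^{-ν}`. -/
lemma integral_exp_mul_fracIntegral (hβ : 0 < β) (hν : 0 < ν) {f : ℝ → ℝ}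
    (hf : IntegrableOn (fun y => Real.exp (-β * y) * f y) (Set.Ioi 0)) :
    IntegrableOn (fun y => Real.exp (-β * y) * fracIntegral ν f y) (Set.Ioi 0) ∧
    ∫ y in Set.Ioi 0, Real.exp (-β * y) * fracIntegral ν f y
      = (β ^ ν)⁻¹ * ∫ y in Set.Ioi 0, Real.exp (-β * y) * f y := by
  have hG := (Real.Gamma_pos_of_pos hν).ne'
  have hg : IntegrableOn (fun s : ℝ => s ^ (ν - 1) * Real.exp (-(β * s))) (Set.Ioi 0) := by
    by_contra h
    have h2 := integral_undef h
    rw [Real.integral_rpow_mul_exp_neg_mul_Ioi hν hβ] at h2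
    have : 0 < (1 / β) ^ ν * Real.Gamma ν := mul_pos (by positivity) (Real.Gamma_pos_of_pos hν)
    exact this.ne' h2
  have key : ∀ x, ∫ s in (0 : ℝ)..x, ContinuousLinearMap.mul ℝ ℝ (Real.exp (-β * s) * f s)
      ((x - s) ^ (ν - 1) * Real.exp (-(β * (x - s))))
      = Real.Gamma ν * (Real.exp (-β * x) * fracIntegral ν f x) := by
    intro x
    unfold fracIntegral
    rw [mul_left_comm, mul_inv_cancel_left₀ hG, ← intervalIntegral.integral_const_mul]
    congr 1 with s
    rw [ContinuousLinearMap.mul_apply', show -β * x = -β * s + -(β * (x - s)) by ring, Real.exp_add]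
    ring
  constructor
  · have h := (integrable_posConvolution hf hg (ContinuousLinearMap.mul ℝ ℝ)).integrableOn
      (s := Set.Ioi 0)
    refine (h.const_mul (Real.Gamma ν)⁻¹).congr ?_
    refine (ae_restrict_mem measurableSet_Ioi).mono fun x hx => ?_
    simp only [posConvolution, Set.indicator_of_mem hx]
    rw [key, inv_mul_cancel_left₀ hG]
  · have h := integral_posConvolution hf hg (ContinuousLinearMap.mul ℝ ℝ)
    simp_rw [key] at h
    rw [integral_const_mul, ContinuousLinearMap.mul_apply',
      Real.integral_rpow_mul_exp_neg_mul_Ioi hν hβ] at h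
    have h3 := mul_left_cancel₀ hG (h.trans (by ring : _ = Real.Gamma ν *
      ((1 / β) ^ ν * ∫ x in Set.Ioi 0, Real.exp (-β * x) * f x)))
    rw [h3, one_div, Real.inv_rpow hβ.le]

lemma laplace_succ (hp : IsLinearBirthSolution ν lam p) (hβ : 0 < β) (hν : 0 < ν) (n : ℕ) :
    ∫ y in Set.Ioi 0, Real.exp (-β * y) * p (n + 1) y
      = (if n = 0 then 1 else 0) / β + (β ^ ν)⁻¹ *
        (-(lam * (n + 1)) * (∫ y in Set.Ioi 0, Real.exp (-β * y) * p (n + 1) y)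
          + lam * n * ∫ y in Set.Ioi 0, Real.exp (-β * y) * p n y) := by
  have e : ∀ y, Real.exp (-β * y) * (-(lam * (n + 1)) * p (n + 1) y + lam * n * p n y)
      = -(lam * (n + 1)) * (Real.exp (-β * y) * p (n + 1) y)
        + lam * n * (Real.exp (-β * y) * p n y) := fun y => by ring
  have i1 := (hp.integrableOn_exp_mul hβ (n + 1) 0).const_mul (-(lam * (n + 1)))
  have i2 := (hp.integrableOn_exp_mul hβ n 0).const_mul (lam * n)
  have hf : IntegrableOn (fun y => Real.exp (-β * y) *
      (-(lam * (n + 1)) * p (n + 1) y + lam * n * p n y)) (Set.Ioi 0) := by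
    simp_rw [e]
    exact i1.add i2
  obtain ⟨h1, h2⟩ := integral_exp_mul_fracIntegral hβ hν hf
  have hE := integrableOn_exp_mul_Ioi (neg_neg_of_pos hβ) 0
  calc ∫ y in Set.Ioi 0, Real.exp (-β * y) * p (n + 1) y
      = ∫ y in Set.Ioi 0, (Real.exp (-β * y) * (if n = 0 then 1 else 0) + Real.exp (-β * y) *
          fracIntegral ν (fun s => -(lam * (n + 1)) * p (n + 1) s + lam * n * p n s) y) := by
        refine setIntegral_congr_fun measurableSet_Ioi fun y hy => ?_
        rw [hp.equation n y hy, mul_add]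
    _ = _ := by
        rw [integral_add (hE.mul_const _) h1, h2, integral_mul_const,
          integral_exp_mul_Ioi (neg_neg_of_pos hβ)]
        simp_rw [e]
        rw [integral_add i1 i2, integral_const_mul, integral_const_mul]
        simp only [mul_zero, Real.exp_zero]
        congr 1
        ring

/-- With `a = β ^ ν / lam`, solving `laplace_succ` for its left side makes the ratio of the
transforms of `p (n + 1)` and `p n` equal to `n / (a + n + 1)`, which is the ratio of consecutive
Gamma quotients. Termwise transformation of the series is avoided, as it would need `lam * n < β ^
ν`. -/
lemma laplace_eq (hp : IsLinearBirthSolution ν lam p) (hβ : 0 < β) (hν : 0 < ν)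
    (hlam : 0 < lam) (n : ℕ) :
    ∫ y in Set.Ioi 0, Real.exp (-β * y) * p (n + 1) y
      = β ^ (ν - 1) / lam * (Real.Gamma (β ^ ν / lam + 1) * Real.Gamma (n + 1 : ℕ)
          / Real.Gamma (β ^ ν / lam + (n + 1 : ℕ) + 1)) := by
  have hb := Real.rpow_pos_of_pos hβ ν
  set a := β ^ ν / lam with ha
  have ha0 : 0 < a := div_pos hb hlam
  have hbl : β ^ ν = a * lam := by rw [ha]; field_simp
  induction n with
  | zero =>
    have h := hp.laplace_succ hβ hν 0
    simp only [if_true, Nat.cast_zero, zero_add, mul_one, mul_zero, zero_mul, add_zero,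
      Nat.cast_one, Real.Gamma_one] at h ⊢
    rw [Real.Gamma_add_one (show a + 1 ≠ 0 by positivity), Real.rpow_sub_one hβ.ne', hbl]
    have hG := (Real.Gamma_pos_of_pos (show 0 < a + 1 by positivity)).ne'
    rw [hbl] at h
    field_simp at h ⊢
    linear_combination h
  | succ n ih =>
    have h := hp.laplace_succ hβ hν (n + 1)
    rw [if_neg (Nat.succ_ne_zero n), zero_div, zero_add, ih] at h
    have e1 : Real.Gamma ((n + 1 + 1 : ℕ) : ℝ) = (n + 1) * Real.Gamma ((n + 1 : ℕ) : ℝ) := by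
      push_cast
      rw [Real.Gamma_add_one (by positivity)]
    have e2 : Real.Gamma (a + (n + 1 + 1 : ℕ) + 1)
        = (a + n + 2) * Real.Gamma (a + (n + 1 : ℕ) + 1) := by
      rw [Real.Gamma_add_one (by positivity)]
      push_cast
      rw [show a + (n + 1 + 1) = a + (n + 1) + 1 by ring]
      ring
    rw [e1, e2]
    have hG : Real.Gamma (a + (n + 1 : ℕ) + 1) ≠ 0 :=
      (Real.Gamma_pos_of_pos (by positivity)).ne'
    rw [hbl] at h
    generalize Real.Gamma (a + (n + 1 : ℕ) + 1) = G at *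
    generalize Real.Gamma ((n + 1 : ℕ) : ℝ) = G' at *
    generalize Real.Gamma (a + 1) = G'' at *
    generalize β ^ (ν - 1) = B at *
    generalize (∫ y in Set.Ioi 0, Real.exp (-β * y) * p (n + 1 + 1) y) = I at *
    clear_value a
    push_cast at h
    have : a + n + 2 ≠ 0 := by positivity
    field_simp at h ⊢
    linear_combination h

end IsLinearBirthSolution

/-! ### The Yule–Simon distribution -/

/-- Both sides are the Beta integral of `x^{a-1} (1 - x)^n`. The induction uses Pascal's rule, which
expresses the sum for `n + 1` at `a` as the difference of the sums for `n` at `a` and at `a + 1`. -/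
lemma sum_choose_div_add {a : ℝ} (ha : 0 < a) (n : ℕ) :
    ∑ j ∈ Finset.range (n + 1), (n.choose j : ℝ) * (-1) ^ j * (1 / (a + j))
      = Real.Gamma a * Real.Gamma (n + 1 : ℕ) / Real.Gamma (a + (n + 1 : ℕ)) := by
  induction n generalizing a with
  | zero =>
    have := (Real.Gamma_pos_of_pos ha).ne'
    simp [Real.Gamma_add_one ha.ne']
    field_simp
  | succ n ih =>
    have h : ∑ j ∈ Finset.range (n + 1 + 1), ((n + 1).choose j : ℝ) * (-1) ^ j * (1 / (a + j))
        = ∑ j ∈ Finset.range (n + 1), (n.choose j : ℝ) * (-1) ^ j * (1 / (a + j))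
          - ∑ j ∈ Finset.range (n + 1), (n.choose j : ℝ) * (-1) ^ j * (1 / (a + 1 + j)) := by
      rw [Finset.sum_range_succ']
      have h1 : ∑ j ∈ Finset.range (n + 1), (n.choose j : ℝ) * (-1) ^ j * (1 / (a + j))
          = ∑ j ∈ Finset.range (n + 1),
              (n.choose (j + 1) : ℝ) * (-1) ^ (j + 1) * (1 / (a + (j + 1 : ℕ))) + 1 / a := by
        have h2 := Finset.sum_range_succ'
          (fun j => (n.choose j : ℝ) * (-1) ^ j * (1 / (a + j))) (n + 1)
        rw [Finset.sum_range_succ] at h2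
        simpa using h2
      rw [h1, add_sub_right_comm, ← Finset.sum_sub_distrib]
      congr 1
      · refine Finset.sum_congr rfl fun j _ => ?_
        rw [Nat.choose_succ_succ]
        push_cast
        rw [show a + 1 + (j : ℝ) = a + (j + 1) by ring]
        ring
      · simp
    rw [h, ih ha, ih (show 0 < a + 1 by positivity)]
    have e1 : Real.Gamma ((n + 1 + 1 : ℕ) : ℝ) = (n + 1) * Real.Gamma ((n + 1 : ℕ) : ℝ) := by
      push_cast
      rw [Real.Gamma_add_one (by positivity)]
    have e2 : Real.Gamma (a + (n + 1 + 1 : ℕ)) = (a + n + 1) * Real.Gamma (a + (n + 1 : ℕ)) := by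
      rw [show a + ((n + 1 + 1 : ℕ) : ℝ) = a + (n + 1 : ℕ) + 1 by push_cast; ring,
        Real.Gamma_add_one (by positivity)]
      push_cast
      ring
    have e3 : Real.Gamma (a + 1 + (n + 1 : ℕ)) = (a + n + 1) * Real.Gamma (a + (n + 1 : ℕ)) := by
      rw [← e2]
      push_cast
      ring_nf
    have hG : Real.Gamma (a + (n + 1 : ℕ)) ≠ 0 := (Real.Gamma_pos_of_pos (by positivity)).ne'
    rw [e1, e2, e3, Real.Gamma_add_one ha.ne']
    have : a + n + 1 ≠ 0 := by positivity
    field_simp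
    ring

lemma sum_choose_div_eq_yuleSimon {a : ℝ} (ha : 0 < a) (n : ℕ) :
    ∑ j ∈ Finset.range (n + 1), (n.choose j : ℝ) * (-1) ^ j * (a / (a + (j + 1 : ℕ)))
      = yuleSimon a (n + 1) := by
  have h := sum_choose_div_add (show 0 < a + 1 by positivity) n
  rw [yuleSimon, show a + ((n + 1 : ℕ) : ℝ) + 1 = a + 1 + (n + 1 : ℕ) by ring, ← h, Finset.mul_sum]
  refine Finset.sum_congr rfl fun j _ => ?_
  push_cast
  rw [show a + 1 + (j : ℝ) = a + (j + 1) by ring]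
  ring

/-- For `n > 0` the quotient equals `a * n ^ (-a) * GammaSeq a n`, and Euler's sequence converges to
`Γ(a)`. -/
lemma tendsto_Gamma_mul_div_Gamma_add {a : ℝ} (ha : 0 < a) :
    Tendsto (fun n : ℕ => Real.Gamma (a + 1) * Real.Gamma (n + 1 : ℕ) / Real.Gamma (a + (n + 1 : ℕ)))
      atTop (𝓝 0) := by
  have hprod : ∀ n : ℕ, Real.Gamma (a + (n + 1 : ℕ))
      = Real.Gamma a * ∏ j ∈ Finset.range (n + 1), (a + j) := by
    intro n
    induction n with
    | zero => simp [Real.Gamma_add_one ha.ne', mul_comm]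
    | succ n ih =>
      rw [Finset.prod_range_succ, ← mul_assoc, ← ih,
        show a + ((n + 1 + 1 : ℕ) : ℝ) = a + (n + 1 : ℕ) + 1 by push_cast; ring,
        Real.Gamma_add_one (by positivity), mul_comm]
  have h1 := Real.GammaSeq_tendsto_Gamma a
  have h2 : Tendsto (fun n : ℕ => (n : ℝ) ^ (-a)) atTop (𝓝 0) :=
    (tendsto_rpow_neg_atTop ha).comp tendsto_natCast_atTop_atTop
  have h3 := (h1.mul h2).const_mul a
  rw [mul_zero, mul_zero] at h3
  refine h3.congr' ?_
  filter_upwards [eventually_gt_atTop 0] with n hn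
  have hn' : (0 : ℝ) < n := Nat.cast_pos.2 hn
  have hP : 0 < ∏ j ∈ Finset.range (n + 1), (a + j) :=
    Finset.prod_pos fun j _ => by positivity
  have hG := (Real.Gamma_pos_of_pos ha).ne'
  have hpow := (Real.rpow_pos_of_pos hn' a).ne'
  rw [hprod, Real.GammaSeq, Real.rpow_neg hn'.le, Real.Gamma_add_one ha.ne', Nat.cast_succ,
    Real.Gamma_nat_eq_factorial]
  field_simp

lemma hasSum_yuleSimon {a : ℝ} (ha : 0 < a) : HasSum (fun m : ℕ => yuleSimon a (m + 1)) 1 := by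
  have hnn : ∀ m : ℕ, 0 ≤ yuleSimon a (m + 1) := by
    intro m
    have h1 := Real.Gamma_pos_of_pos (show 0 < a + 1 by positivity)
    have h2 := Real.Gamma_pos_of_pos (show (0 : ℝ) < (m + 1 : ℕ) by positivity)
    have h3 := Real.Gamma_pos_of_pos (show 0 < a + (m + 1 : ℕ) + 1 by positivity)
    unfold yuleSimon
    positivity
  rw [hasSum_iff_tendsto_nat_of_nonneg hnn]
  -- `G` is the tail of the Yule–Simon law: the weights are its decrements, so the series telescopes
  -- from `G 0 = 1`.
  set G : ℕ → ℝ := fun n =>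
    Real.Gamma (a + 1) * Real.Gamma (n + 1 : ℕ) / Real.Gamma (a + (n + 1 : ℕ)) with hGdef
  have hstep : ∀ m, yuleSimon a (m + 1) = G m - G (m + 1) := by
    intro m
    have hG : Real.Gamma (a + (m + 1 : ℕ)) ≠ 0 := (Real.Gamma_pos_of_pos (by positivity)).ne'
    have e1 : Real.Gamma ((m + 1 + 1 : ℕ) : ℝ) = (m + 1) * Real.Gamma ((m + 1 : ℕ) : ℝ) := by
      push_cast
      rw [Real.Gamma_add_one (by positivity)]
    have e2 : Real.Gamma (a + (m + 1 : ℕ) + 1) = (a + m + 1) * Real.Gamma (a + (m + 1 : ℕ)) := by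
      rw [Real.Gamma_add_one (by positivity)]
      push_cast
      ring
    have e3 : Real.Gamma (a + (m + 1 + 1 : ℕ)) = (a + m + 1) * Real.Gamma (a + (m + 1 : ℕ)) := by
      rw [← e2]
      push_cast
      ring_nf
    simp only [hGdef]
    rw [yuleSimon, e1, e2, e3]
    have : a + m + 1 ≠ 0 := by positivity
    field_simp
    ring
  have hG0 : G 0 = 1 := by
    have := (Real.Gamma_pos_of_pos (show 0 < a + 1 by positivity)).ne'
    simp [hGdef, this]
  simp_rw [hstep, Finset.sum_range_sub', hG0]
  have h := (tendsto_Gamma_mul_div_Gamma_add ha).const_sub 1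
  rwa [sub_zero] at h

/-! ### Decomposition of a Yule process at its last jump -/

section Decay

variable {Ω : Type*} [MeasurableSpace Ω] {P : Measure Ω}

/-- The expectation of `Z * exp (-r (t - T))` on the event `T ≤ t`. -/
noncomputable def decay (P : Measure Ω) (r : ℝ) (T : Ω → ℝ) (Z : Ω → ℝ≥0∞) (t : ℝ) : ℝ≥0∞ :=
  ∫⁻ ω, {ω | T ω ≤ t}.indicator (fun ω => Z ω * ENNReal.ofReal (Real.exp (-(r * (t - T ω))))) ω ∂P

lemma lintegral_expMeasure {r : ℝ} {f : ℝ → ℝ≥0∞} (hf : Measurable f) :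
    ∫⁻ s, f s ∂(expMeasure r)
      = ∫⁻ s in Set.Ici 0, ENNReal.ofReal (r * Real.exp (-(r * s))) * f s := by
  have h : expMeasure r = volume.withDensity (exponentialPDF r) := rfl
  rw [h, lintegral_withDensity_eq_lintegral_mul _
    (show Measurable (exponentialPDF r) from (measurable_exponentialPDFReal r).ennreal_ofReal) hf, ← lintegral_indicator measurableSet_Ici]
  congr 1 with s
  simp only [Pi.mul_apply, exponentialPDF_eq, Set.indicator, Set.mem_Ici]
  split_ifs <;> simp

lemma expMeasure_Ioi {r : ℝ} (hr : 0 < r) {x : ℝ} (hx : 0 ≤ x) :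
    expMeasure r (Set.Ioi x) = ENNReal.ofReal (Real.exp (-(r * x))) := by
  have := isProbabilityMeasure_expMeasure hr
  have h1 := cdf_expMeasure_eq hr x
  rw [if_pos hx, cdf_eq_real] at h1
  have h2 := prob_compl_eq_one_sub (μ := expMeasure r) (measurableSet_Iic (a := x))
  rw [Set.compl_Iic] at h2
  have hle : Real.exp (-(r * x)) ≤ 1 := Real.exp_le_one_iff.2 (by nlinarith)
  rw [h2, ← ofReal_measureReal, h1, ← ENNReal.ofReal_one, ← ENNReal.ofReal_sub _ (by linarith)]
  congr 1
  ring

lemma expMeasure_Iio_zero {r : ℝ} (hr : 0 < r) : expMeasure r (Set.Iio 0) = 0 := by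
  have := isProbabilityMeasure_expMeasure hr
  have h1 := cdf_expMeasure_eq hr 0
  rw [if_pos le_rfl, cdf_eq_real, mul_zero, neg_zero, Real.exp_zero, sub_self,
    measureReal_eq_zero_iff] at h1
  exact measure_mono_null Set.Iio_subset_Iic_self h1

lemma lintegral_indep_expMeasure [IsProbabilityMeasure P] {𝓤 : Type*} [MeasurableSpace 𝓤] {U : Ω → 𝓤}
    {V : Ω → ℝ} {r : ℝ} (hr : 0 < r) (hU : Measurable U) (hV : Measurable V)
    (hind : IndepFun U V P) (hlaw : P.map V = expMeasure r) {F : 𝓤 → ℝ → ℝ≥0∞}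
    (hF : Measurable (Function.uncurry F)) :
    ∫⁻ ω, F (U ω) (V ω) ∂P = ∫⁻ ω, ∫⁻ s, F (U ω) s ∂(expMeasure r) ∂P := by
  have := isProbabilityMeasure_expMeasure hr
  have h1 := (indepFun_iff_map_prod_eq_prod_map_map hU.aemeasurable hV.aemeasurable).1 hind
  have h2 : ∫⁻ ω, F (U ω) (V ω) ∂P
      = ∫⁻ z, Function.uncurry F z ∂(P.map fun ω => (U ω, V ω)) := by
    rw [lintegral_map hF (hU.prodMk hV)]
    rfl
  rw [h2, h1, hlaw, lintegral_prod _ hF.aemeasurable, lintegral_map _ hU]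
  · rfl
  · exact hF.lintegral_prod_right'

variable [IsProbabilityMeasure P] {T S : Ω → ℝ} {Z : Ω → ℝ≥0∞} {r : ℝ}

/-- Integrating out the independent exponential `S` replaces the condition `t < T + S` by the
survival probability `e^{-r(t - T)}`. -/
lemma lintegral_indicator_lt_add (hr : 0 < r) (hT : Measurable T) (hZ : Measurable Z)
    (hS : Measurable S) (hind : IndepFun (fun ω => (T ω, Z ω)) S P)
    (hlaw : P.map S = expMeasure r) (t : ℝ) :
    ∫⁻ ω, {ω | T ω ≤ t ∧ t < T ω + S ω}.indicator Z ω ∂P = decay P r T Z t := by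
  set F : ℝ × ℝ≥0∞ → ℝ → ℝ≥0∞ := fun z s =>
    {q : (ℝ × ℝ≥0∞) × ℝ | q.1.1 ≤ t ∧ t < q.1.1 + q.2}.indicator (fun q => q.1.2) (z, s) with hFdef
  have hF : Measurable (Function.uncurry F) := by
    refine Measurable.indicator (by fun_prop) ?_
    exact (measurableSet_le (f := fun q : (ℝ × ℝ≥0∞) × ℝ => q.1.1) (by fun_prop)
      measurable_const).inter (measurableSet_lt (g := fun q : (ℝ × ℝ≥0∞) × ℝ => q.1.1 + q.2)
      measurable_const (by fun_prop))
  have h := lintegral_indep_expMeasure hr (hT.prodMk hZ) hS hind hlaw hF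
  have h0 : ∀ ω, {ω | T ω ≤ t ∧ t < T ω + S ω}.indicator Z ω = F (T ω, Z ω) (S ω) := fun ω => rfl
  simp_rw [h0]
  rw [h, decay]
  congr 1 with ω
  by_cases hω : T ω ≤ t
  · rw [Set.indicator_of_mem (by exact hω), ← expMeasure_Ioi hr (sub_nonneg.2 hω),
      ← lintegral_indicator_const measurableSet_Ioi]
    congr 1 with s
    simp only [hFdef, Set.indicator, Set.mem_ofPred_eq, hω, true_and, Set.mem_Ioi, sub_lt_iff_lt_add']
  · rw [Set.indicator_of_notMem (by exact hω)]
    simp [hFdef, Set.indicator, hω]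

/-- Conditionally on `(T, Z)`, the next jump `u = T + S` has density `r e^{-r(u - T)}` on `u ≥ T`.
The factor `e^{-r(u - T)}` is again the weight inside `decay` at time `u`, so the quantities for
successive jumps satisfy a closed recursion. -/
lemma decay_add (hr : 0 < r) (r' : ℝ) (hT : Measurable T) (hZ : Measurable Z)
    (hS : Measurable S) (hind : IndepFun (fun ω => (T ω, Z ω)) S P)
    (hlaw : P.map S = expMeasure r) {h : ℝ → ℝ≥0∞} (hh : Measurable h) (t : ℝ) :
    decay P r' (fun ω => T ω + S ω) (fun ω => Z ω + h (T ω + S ω)) t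
      = ∫⁻ u in Set.Iic t, ENNReal.ofReal (r * Real.exp (-(r' * (t - u)))) *
          (decay P r T Z u + h u * decay P r T 1 u) := by
  set F : ℝ × ℝ≥0∞ → ℝ → ℝ≥0∞ := fun z s =>
    {q : (ℝ × ℝ≥0∞) × ℝ | q.1.1 + q.2 ≤ t}.indicator (fun q => (q.1.2 + h (q.1.1 + q.2)) *
      ENNReal.ofReal (Real.exp (-(r' * (t - (q.1.1 + q.2)))))) (z, s) with hFdef
  have hF : Measurable (Function.uncurry F) :=
    Measurable.indicator (by fun_prop) (measurableSet_le (by fun_prop) measurable_const)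
  have h1 := lintegral_indep_expMeasure hr (hT.prodMk hZ) hS hind hlaw hF
  have h0 : decay P r' (fun ω => T ω + S ω) (fun ω => Z ω + h (T ω + S ω)) t
      = ∫⁻ ω, F (T ω, Z ω) (S ω) ∂P := by
    rw [decay]
    congr 1 with ω
  set K : Ω → ℝ → ℝ≥0∞ := fun ω u => ENNReal.ofReal (r * Real.exp (-(r' * (t - u)))) *
    ((Set.Ici (T ω)).indicator (fun u =>
      (Z ω + h u) * ENNReal.ofReal (Real.exp (-(r * (u - T ω))))) u) with hKdef
  have hK : Measurable (Function.uncurry K) := by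
    have e : Function.uncurry K = fun z : Ω × ℝ =>
        ENNReal.ofReal (r * Real.exp (-(r' * (t - z.2)))) * {z : Ω × ℝ | T z.1 ≤ z.2}.indicator
          (fun z => (Z z.1 + h z.2) * ENNReal.ofReal (Real.exp (-(r * (z.2 - T z.1))))) z := by
      ext z
      simp only [Function.uncurry, hKdef, Set.indicator, Set.mem_Ici, Set.mem_ofPred_eq]
    rw [e]
    refine Measurable.mul (by fun_prop) (Measurable.indicator (by fun_prop) ?_)
    exact measurableSet_le (by fun_prop) (by fun_prop)
  have h2 : ∀ ω, ∫⁻ s, F (T ω, Z ω) s ∂(expMeasure r) = ∫⁻ u in Set.Iic t, K ω u := by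
    intro ω
    rw [lintegral_expMeasure (hF.of_uncurry_left), ← lintegral_indicator measurableSet_Ici,
      ← lintegral_indicator measurableSet_Iic, ← lintegral_sub_right_eq_self _ (T ω)]
    congr 1 with u
    simp only [hFdef, hKdef, Set.indicator, Set.mem_Ici, Set.mem_Iic, Set.mem_ofPred_eq, sub_nonneg,
      add_sub_cancel]
    by_cases a : T ω ≤ u <;> by_cases b : u ≤ t <;> simp only [a, b, if_true, if_false, mul_zero]
    rw [ENNReal.ofReal_mul hr.le, ENNReal.ofReal_mul hr.le]
    ring
  rw [h0, h1]
  simp_rw [h2]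
  rw [lintegral_lintegral_swap hK.aemeasurable]
  refine lintegral_congr fun u => ?_
  simp only [hKdef]
  have hind : ∀ f : Ω → ℝ≥0∞, Measurable f →
      Measurable ({ω | T ω ≤ u}.indicator fun ω =>
        f ω * ENNReal.ofReal (Real.exp (-(r * (u - T ω))))) := by
    intro f hf
    exact Measurable.indicator (by fun_prop) (measurableSet_le hT measurable_const)
  rw [lintegral_const_mul']
  swap
  · exact ENNReal.ofReal_ne_top
  congr 1
  rw [decay, decay, ← lintegral_const_mul _ (hind 1 measurable_one), ← lintegral_add_left (hind Z hZ)]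
  congr 1 with ω
  simp only [Set.indicator, Set.mem_Ici, Set.mem_ofPred_eq, Pi.one_apply]
  split_ifs
  · ring
  · simp

end Decay

/-! ### The Yule process -/

section Yule

variable {Ω : Type*} [MeasurableSpace Ω] {P : Measure Ω} {β : ℝ}
  {S : ℕ → Ω → ℝ} {h : ℝ → ℝ}

/-- The sum of `h` over the creation times of the webpages `1, …, m`. -/
noncomputable def jumpSum (S : ℕ → Ω → ℝ) (h : ℝ → ℝ) (m : ℕ) (ω : Ω) : ℝ≥0∞ :=
  ∑ k ∈ Finset.range m, ENNReal.ofReal (h (creationTime S (k + 1) ω))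

/-- The holding times of a Yule process of rate `β`. -/
structure IsYuleHolding (P : Measure Ω) (β : ℝ) (S : ℕ → Ω → ℝ) : Prop where
  measurable : ∀ k, Measurable (S k)
  law : ∀ k : ℕ, P.map (S k) = expMeasure (β * (k + 1))
  indep : iIndepFun S P

lemma measurable_creationTime (hS : ∀ k, Measurable (S k)) (k : ℕ) :
    Measurable (creationTime S k) :=
  Finset.measurable_fun_sum _ fun i _ => hS i

lemma measurable_jumpSum (hS : ∀ k, Measurable (S k)) (hh : Measurable h) (m : ℕ) :
    Measurable (jumpSum S h m) :=
  Finset.measurable_fun_sum _ fun k _ => (hh.comp (measurable_creationTime hS (k + 1))).ennreal_ofReal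

lemma creationTime_succ {Ω : Type*} (S : ℕ → Ω → ℝ) (m : ℕ) (ω : Ω) :
    creationTime S (m + 1) ω = creationTime S m ω + S m ω := Finset.sum_range_succ _ _

lemma jumpSum_succ {Ω : Type*} (S : ℕ → Ω → ℝ) (h : ℝ → ℝ) (m : ℕ) (ω : Ω) :
    jumpSum S h (m + 1) ω
      = jumpSum S h m ω + ENNReal.ofReal (h (creationTime S m ω + S m ω)) := by
  rw [jumpSum, Finset.sum_range_succ, creationTime_succ, jumpSum]

lemma IsYuleHolding.indepFun_creationTime (hS : IsYuleHolding P β S) (hh : Measurable h) (m : ℕ) :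
    IndepFun (fun ω => (creationTime S m ω, jumpSum S h m ω)) (S m) P := by
  have h1 := hS.indep.indepFun_finset (Finset.range m) {m} (by simp) hS.measurable
  -- Extending a finite tuple by zero exhibits the creation time and the jump sum as functions of
  -- the first `m` holding times alone.
  set S' : ℕ → (Finset.range m → ℝ) → ℝ := fun i u =>
    if hi : i ∈ Finset.range m then u ⟨i, hi⟩ else 0 with hS'
  have hS'm : ∀ i, Measurable (S' i) := by
    intro i
    by_cases hi : i ∈ Finset.range m
    · simp only [hS', hi, dif_pos]
      fun_prop
    · simp only [hS', hi, dif_neg, not_false_eq_true]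
      fun_prop
  have hc : ∀ k ≤ m, ∀ ω,
      creationTime S' k (fun i : Finset.range m => S i ω) = creationTime S k ω := by
    intro k hk ω
    refine Finset.sum_congr rfl fun i hi => ?_
    have : i ∈ Finset.range m := Finset.mem_range.2 ((Finset.mem_range.1 hi).trans_le hk)
    simp only [hS', this, dif_pos]
  have hφ : Measurable fun u => (creationTime S' m u, jumpSum S' h m u) :=
    (measurable_creationTime hS'm m).prodMk (measurable_jumpSum hS'm hh m)
  have hψ : Measurable fun u : ({m} : Finset ℕ) → ℝ => u ⟨m, Finset.mem_singleton_self m⟩ := by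
    fun_prop
  have h2 := h1.comp hφ hψ
  have e : (fun ω => (creationTime S m ω, jumpSum S h m ω))
      = (fun u => (creationTime S' m u, jumpSum S' h m u)) ∘
        fun ω (i : Finset.range m) => S i ω := by
    ext ω
    · exact (hc m le_rfl ω).symm
    · simp only [Function.comp, jumpSum]
      refine Finset.sum_congr rfl fun k hk => ?_
      rw [hc _ (Finset.mem_range.1 hk)]
  rw [e]
  exact h2

/-- The integral of `h`, weighted by the rate `β exp (β s)` of the ages in a Yule process. -/
noncomputable def ageIntegral (β : ℝ) (h : ℝ → ℝ) (t : ℝ) : ℝ :=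
  ∫ s in (0 : ℝ)..t, β * Real.exp (β * s) * h s

lemma ageIntegral_nonneg (hβ : 0 < β) (h0 : ∀ s, 0 ≤ h s) {t : ℝ} (ht : 0 ≤ t) :
    0 ≤ ageIntegral β h t :=
  intervalIntegral.integral_nonneg ht fun s _ => mul_nonneg (by positivity) (h0 s)

lemma hasDerivAt_ageIntegral (β : ℝ) (hh : Continuous h) (t : ℝ) :
    HasDerivAt (ageIntegral β h) (β * Real.exp (β * t) * h t) t := by
  have hc : Continuous fun s => β * Real.exp (β * s) * h s := by fun_prop
  exact intervalIntegral.integral_hasDerivAt_right (hc.intervalIntegrable _ _)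
    hc.stronglyMeasurable.stronglyMeasurableAtFilter hc.continuousAt

/-- The fundamental theorem of calculus in the form needed by the recursions below, where nothing
happens before time `0`. -/
lemma setLIntegral_Iic_ofReal_eq_sub {f G : ℝ → ℝ} {t : ℝ} (ht : 0 ≤ t) (hf : Continuous f)
    (hf0 : ∀ u, 0 ≤ u → 0 ≤ f u) (hG : ∀ u, HasDerivAt G (f u) u) {g : ℝ → ℝ≥0∞}
    (hg0 : ∀ u < 0, g u = 0) (hg : ∀ u, 0 ≤ u → g u = ENNReal.ofReal (f u)) :
    ∫⁻ u in Set.Iic t, g u = ENNReal.ofReal (G t - G 0) := by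
  have h1 : ∫⁻ u in Set.Iic t, g u = ∫⁻ u in Set.Icc 0 t, ENNReal.ofReal (f u) := by
    rw [← lintegral_indicator measurableSet_Iic, ← lintegral_indicator measurableSet_Icc]
    congr 1 with u
    simp only [Set.indicator, Set.mem_Iic, Set.mem_Icc]
    rcases lt_or_ge u 0 with hu | hu
    · simp [hg0 u hu, hu.not_ge]
    · simp [hg u hu, hu]
  rw [h1, setLIntegral_congr Ioc_ae_eq_Icc.symm, ← ofReal_integral_eq_lintegral_ofReal]
  · rw [← intervalIntegral.integral_of_le ht,
      intervalIntegral.integral_eq_sub_of_hasDerivAt (fun u _ => hG u) (hf.intervalIntegrable _ _)]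
  · exact hf.integrableOn_Ioc
  · exact (ae_restrict_mem measurableSet_Ioc).mono fun u hu => hf0 u hu.1.le

lemma exp_neg_mul_le_one (hβ : 0 < β) {u : ℝ} (hu : 0 ≤ u) : Real.exp (-(β * u)) ≤ 1 :=
  Real.exp_le_one_iff.2 (by nlinarith)

/-- The probability that a Yule process of rate `β` has `m + 1` individuals at time `t`. -/
noncomputable def yuleProb (β : ℝ) (m : ℕ) (t : ℝ) : ℝ :=
  Real.exp (-(β * t)) * (1 - Real.exp (-(β * t))) ^ m

/-- The factor of `ageIntegral β h t` in the expectation of `jumpSum S h m` on the event that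
a Yule process of rate `β` has `m + 1` individuals at time `t`. -/
noncomputable def yuleWeight (β : ℝ) (m : ℕ) (t : ℝ) : ℝ :=
  m * (1 - Real.exp (-(β * t))) ^ (m - 1) * Real.exp (-(β * t)) ^ 2

lemma yuleProb_nonneg (hβ : 0 < β) (m : ℕ) {t : ℝ} (ht : 0 ≤ t) : 0 ≤ yuleProb β m t :=
  mul_nonneg (Real.exp_pos _).le (pow_nonneg (sub_nonneg.2 (exp_neg_mul_le_one hβ ht)) _)

lemma yuleWeight_nonneg (hβ : 0 < β) (m : ℕ) {t : ℝ} (ht : 0 ≤ t) : 0 ≤ yuleWeight β m t := by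
  have := pow_nonneg (sub_nonneg.2 (exp_neg_mul_le_one hβ ht)) (m - 1)
  unfold yuleWeight
  positivity

lemma hasDerivAt_exp_neg_mul (β u : ℝ) :
    HasDerivAt (fun u => Real.exp (-(β * u))) (-β * Real.exp (-(β * u))) u := by
  convert! ((hasDerivAt_id u).const_mul β).neg.exp using 1
  simp [mul_comm]

variable [IsProbabilityMeasure P]

lemma IsYuleHolding.decay_one (hS : IsYuleHolding P β S) (hβ : 0 < β) (m : ℕ) (t : ℝ) :
    decay P (β * (m + 1)) (creationTime S m) 1 t
      = if 0 ≤ t then ENNReal.ofReal (yuleProb β m t) else 0 := by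
  induction m generalizing t with
  | zero =>
    have h0 : ∀ ω, creationTime S 0 ω = 0 := fun ω => Finset.sum_range_zero _
    unfold decay
    simp only [h0, yuleProb]
    by_cases ht : 0 ≤ t <;> simp [Set.indicator, ht]
  | succ m ih =>
    have hind := hS.indepFun_creationTime (h := 0) measurable_zero m
    have hind1 : IndepFun (fun ω => (creationTime S m ω, (1 : Ω → ℝ≥0∞) ω)) (S m) P :=
      hind.comp (φ := fun z => (z.1, (1 : ℝ≥0∞))) (ψ := id) (by fun_prop) measurable_id
    have h := decay_add (h := 0) (by positivity) (β * ((m + 1 : ℕ) + 1))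
      (measurable_creationTime hS.measurable m) measurable_one (hS.measurable m) hind1 (hS.law m)
      measurable_zero t
    have e1 : creationTime S (m + 1) = fun ω => creationTime S m ω + S m ω :=
      funext fun ω => creationTime_succ S m ω
    have e2 : (1 : Ω → ℝ≥0∞) = fun ω =>
        (1 : Ω → ℝ≥0∞) ω + (0 : ℝ → ℝ≥0∞) (creationTime S m ω + S m ω) := by
      ext; simp
    rw [e1, e2, h]
    simp only [Pi.zero_apply, zero_mul, add_zero, ih]
    split_ifs with ht
    -- The integrand is an exact derivative. `G` is the claimed formula at time `u` times the weight
    -- from `u` to `t`; it vanishes at `0` because `yuleProb β (m + 1)` does, and at `t` it is the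
    -- claim.
    · set G : ℝ → ℝ := fun u =>
        Real.exp (-(β * ((m + 1 : ℕ) + 1) * (t - u))) * yuleProb β (m + 1) u with hGdef
      have hG0 : G 0 = 0 := by simp [hGdef, yuleProb]
      have hGt : G t = yuleProb β (m + 1) t := by simp [hGdef]
      refine (setLIntegral_Iic_ofReal_eq_sub (G := G) ht (f := fun u =>
        β * (m + 1) * Real.exp (-(β * ((m + 1 : ℕ) + 1) * (t - u))) * yuleProb β m u) ?_ ?_ ?_ ?_ ?_).trans
        (by rw [hG0, sub_zero, hGt])
      · unfold yuleProb
        fun_prop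
      · intro u hu
        have := yuleProb_nonneg hβ m hu
        positivity
      · intro u
        have d1 := hasDerivAt_exp_neg_mul β u
        have d2 : HasDerivAt (fun u => Real.exp (-(β * ((m + 1 : ℕ) + 1) * (t - u))))
            (Real.exp (-(β * ((m + 1 : ℕ) + 1) * (t - u))) * (β * ((m + 1 : ℕ) + 1))) u := by
          convert! (((hasDerivAt_id u).const_sub t).const_mul (β * ((m + 1 : ℕ) + 1))).neg.exp using 1
          simp
        convert! d2.mul (d1.mul ((d1.const_sub 1).pow (m + 1))) using 1
        simp only [yuleProb, Pi.mul_apply, Pi.pow_apply, Nat.add_sub_cancel]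
        push_cast
        ring
      · intro u hu
        simp [hu.not_ge]
      · intro u hu
        rw [if_pos hu, ← ENNReal.ofReal_mul (by positivity)]
    · refine (setLIntegral_congr_fun measurableSet_Iic fun u hu => ?_).trans lintegral_zero
      have : ¬ 0 ≤ u := fun h0 => ht (h0.trans hu)
      simp [this]

/-- The product form carries the probabilistic content: the dependence on `m` and the dependence on
`h` separate, so the law of a typical creation time does not depend on the population size. -/
lemma IsYuleHolding.decay_jumpSum (hS : IsYuleHolding P β S) (hβ : 0 < β) (hh : Continuous h)
    (h0 : ∀ s, 0 ≤ h s) (m : ℕ) (t : ℝ) :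
    decay P (β * (m + 1)) (creationTime S m) (jumpSum S h m) t
      = if 0 ≤ t then ENNReal.ofReal (yuleWeight β m t * ageIntegral β h t) else 0 := by
  induction m generalizing t with
  | zero =>
    unfold decay
    simp [jumpSum, yuleWeight, Set.indicator]
  | succ m ih =>
    have hd := decay_add (by positivity) (β * ((m + 1 : ℕ) + 1))
      (measurable_creationTime hS.measurable m) (measurable_jumpSum hS.measurable hh.measurable m)
      (hS.measurable m) (hS.indepFun_creationTime hh.measurable m) (hS.law m)
      hh.measurable.ennreal_ofReal t
    have e1 : creationTime S (m + 1) = fun ω => creationTime S m ω + S m ω :=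
      funext fun ω => creationTime_succ S m ω
    have e2 : jumpSum S h (m + 1) = fun ω =>
        jumpSum S h m ω + ENNReal.ofReal (h (creationTime S m ω + S m ω)) :=
      funext fun ω => jumpSum_succ S h m ω
    rw [e1, e2, hd]
    simp only [ih, hS.decay_one hβ]
    have hwc : Continuous (ageIntegral β h) :=
      continuous_iff_continuousAt.2 fun u => (hasDerivAt_ageIntegral β hh u).continuousAt
    split_ifs with ht
    · set G : ℝ → ℝ := fun u => Real.exp (-(β * ((m + 1 : ℕ) + 1) * (t - u))) *
        (yuleWeight β (m + 1) u * ageIntegral β h u) with hGdef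
      have hG0 : G 0 = 0 := by simp [hGdef, ageIntegral]
      have hGt : G t = yuleWeight β (m + 1) t * ageIntegral β h t := by simp [hGdef]
      refine (setLIntegral_Iic_ofReal_eq_sub (G := G) ht (f := fun u =>
        β * (m + 1) * Real.exp (-(β * ((m + 1 : ℕ) + 1) * (t - u))) *
          (yuleWeight β m u * ageIntegral β h u + h u * yuleProb β m u)) ?_ ?_ ?_ ?_ ?_).trans
        (by rw [hG0, sub_zero, hGt])
      · unfold yuleProb yuleWeight
        fun_prop
      · intro u hu
        have := yuleProb_nonneg hβ m hu
        have := yuleWeight_nonneg hβ m hu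
        have := ageIntegral_nonneg hβ h0 hu
        have := h0 u
        positivity
      · intro u
        have d1 := hasDerivAt_exp_neg_mul β u
        have d2 : HasDerivAt (fun u => Real.exp (-(β * ((m + 1 : ℕ) + 1) * (t - u))))
            (Real.exp (-(β * ((m + 1 : ℕ) + 1) * (t - u))) * (β * ((m + 1 : ℕ) + 1))) u := by
          convert! (((hasDerivAt_id u).const_sub t).const_mul (β * ((m + 1 : ℕ) + 1))).neg.exp using 1
          simp
        have d3 := hasDerivAt_ageIntegral β hh u
        -- The derivative of `ageIntegral` brings `e^{βu}`, which cancels one of the two factors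
        -- `e^{-βu}` of the weight.
        have e3 : Real.exp (β * u) * Real.exp (-(β * u)) = 1 := by
          rw [← Real.exp_add, add_neg_cancel, Real.exp_zero]
        convert! d2.mul (((((d1.const_sub 1).pow m).const_mul ((m + 1 : ℕ) : ℝ)).mul
          (d1.pow 2)).mul d3) using 1
        simp only [yuleProb, yuleWeight, Pi.mul_apply, Pi.pow_apply]
        generalize Real.exp (-(β * ((m + 1 : ℕ) + 1) * (t - u))) = E
        generalize Real.exp (β * u) = y at *
        generalize Real.exp (-(β * u)) = x at *
        generalize ageIntegral β h u = w
        -- The exponent `m - 1` in `yuleWeight` is truncated, so `m = 0` is separate.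
        rcases m with _ | m
        · simp
          linear_combination (-(β * E * x * h u)) * e3
        · push_cast
          linear_combination (-(E * (m + 2) * (1 - x) ^ (m + 1) * β * x * h u)) * e3
      · intro u hu
        simp [hu.not_ge]
      · intro u hu
        have i1 := yuleProb_nonneg hβ m hu
        have i2 := mul_nonneg (yuleWeight_nonneg hβ m hu) (ageIntegral_nonneg hβ h0 hu)
        rw [if_pos hu, if_pos hu, ← ENNReal.ofReal_mul (h0 u),
          ← ENNReal.ofReal_add i2 (mul_nonneg (h0 u) i1), ← ENNReal.ofReal_mul (by positivity)]
    · refine (setLIntegral_congr_fun measurableSet_Iic fun u hu => ?_).trans lintegral_zero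
      have : ¬ 0 ≤ u := fun h0 => ht (h0.trans hu)
      simp [this]

end Yule

/-! ### The number of webpages -/

section Population

variable {Ω : Type*}

/-- The event that exactly the webpages `0, …, m` are present at time `t`. -/
def popEvent (S : ℕ → Ω → ℝ) (t : ℝ) (m : ℕ) : Set Ω := {ω | ∀ k, creationTime S k ω ≤ t ↔ k ≤ m}

lemma numPages_of_mem_popEvent {S : ℕ → Ω → ℝ} {t : ℝ} {m : ℕ} {ω : Ω} (hω : ω ∈ popEvent S t m) :
    numPages S t ω = m + 1 := by
  have h : {k : ℕ | creationTime S k ω ≤ t} = (Finset.range (m + 1) : Set ℕ) := by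
    ext k
    simp only [Set.mem_ofPred_eq, Finset.coe_range, Set.mem_Iio, Nat.lt_succ_iff]
    exact hω k
  rw [numPages, h, Set.ncard_coe_finset, Finset.card_range]

lemma pairwise_disjoint_popEvent (S : ℕ → Ω → ℝ) (t : ℝ) :
    Pairwise (Function.onFun Disjoint (popEvent S t)) := by
  intro m m' hne
  refine Set.disjoint_left.2 fun ω h h' => hne ?_
  exact le_antisymm ((h' m).1 ((h m).2 le_rfl)) ((h m').1 ((h' m').2 le_rfl))

variable [MeasurableSpace Ω] {P : Measure Ω} {β t : ℝ} {S : ℕ → Ω → ℝ}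

lemma measurableSet_popEvent (hS : ∀ k, Measurable (S k)) (t : ℝ) (m : ℕ) :
    MeasurableSet (popEvent S t m) := by
  rw [popEvent, Set.ofPred_forall]
  refine MeasurableSet.iInter fun k => ?_
  have h : MeasurableSet {ω | creationTime S k ω ≤ t} :=
    measurableSet_le (measurable_creationTime hS k) measurable_const
  by_cases hk : k ≤ m
  · simpa [hk] using h
  · have e : {ω | creationTime S k ω ≤ t ↔ k ≤ m} = {ω | creationTime S k ω ≤ t}ᶜ := by
      ext ω
      simp [hk]
    rw [e]
    exact h.compl

lemma IsYuleHolding.ae_nonneg (hS : IsYuleHolding P β S) (hβ : 0 < β) :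
    ∀ᵐ ω ∂P, ∀ k, 0 ≤ S k ω := by
  refine ae_all_iff.2 fun k => ?_
  have h := expMeasure_Iio_zero (show 0 < β * (k + 1) by positivity)
  rw [← hS.law k, Measure.map_apply (hS.measurable k) measurableSet_Iio] at h
  rw [ae_iff]
  simpa [Set.preimage, not_le] using h

/-- Holding times are nonnegative only almost surely; where they are, creation times increase and
two consecutive ones decide the population size. -/
lemma IsYuleHolding.popEvent_ae_eq (hS : IsYuleHolding P β S) (hβ : 0 < β) (t : ℝ) (m : ℕ) :
    popEvent S t m =ᵐ[P] {ω | creationTime S m ω ≤ t ∧ t < creationTime S m ω + S m ω} := by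
  filter_upwards [hS.ae_nonneg hβ] with ω hω
  have hmono : Monotone fun k => creationTime S k ω :=
    monotone_nat_of_le_succ fun k => by
      rw [creationTime_succ]
      exact le_add_of_nonneg_right (hω k)
  refine propext ⟨fun h => ⟨(h m).2 le_rfl, ?_⟩, fun h k => ⟨fun hk => ?_, fun hk => ?_⟩⟩
  · rw [← creationTime_succ]
    by_contra hc
    have := (h (m + 1)).1 (not_lt.1 hc)
    omega
  · by_contra hc
    have h1 := hmono (show m + 1 ≤ k by omega)
    simp only [creationTime_succ S m] at h1
    exact absurd hk (not_le.2 (h.2.trans_le h1))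
  · exact (hmono hk).trans h.1

variable [IsProbabilityMeasure P]

lemma IsYuleHolding.setLIntegral_popEvent (hS : IsYuleHolding P β S) (hβ : 0 < β) {m : ℕ}
    {Z : Ω → ℝ≥0∞} (hZ : Measurable Z)
    (hind : IndepFun (fun ω => (creationTime S m ω, Z ω)) (S m) P) (t : ℝ) :
    ∫⁻ ω in popEvent S t m, Z ω ∂P = decay P (β * (m + 1)) (creationTime S m) Z t := by
  have hT := measurable_creationTime hS.measurable m
  rw [setLIntegral_congr (hS.popEvent_ae_eq hβ t m), ← lintegral_indicator,
    lintegral_indicator_lt_add (by positivity) hT hZ (hS.measurable m) hind (hS.law m)]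
  exact (measurableSet_le hT measurable_const).inter
    (measurableSet_lt measurable_const (hT.add (hS.measurable m)))

lemma IsYuleHolding.setLIntegral_jumpSum (hS : IsYuleHolding P β S) (hβ : 0 < β) {h : ℝ → ℝ}
    (hh : Continuous h) (h0 : ∀ s, 0 ≤ h s) (ht : 0 ≤ t) (m : ℕ) :
    ∫⁻ ω in popEvent S t m, jumpSum S h m ω ∂P
      = ENNReal.ofReal (yuleWeight β m t * ageIntegral β h t) := by
  rw [hS.setLIntegral_popEvent hβ (measurable_jumpSum hS.measurable hh.measurable m)
    (hS.indepFun_creationTime hh.measurable m), hS.decay_jumpSum hβ hh h0, if_pos ht]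

lemma IsYuleHolding.measure_popEvent (hS : IsYuleHolding P β S) (hβ : 0 < β) (ht : 0 ≤ t) (m : ℕ) :
    P (popEvent S t m) = ENNReal.ofReal (yuleProb β m t) := by
  have hind : IndepFun (fun ω => (creationTime S m ω, (1 : Ω → ℝ≥0∞) ω)) (S m) P :=
    (hS.indepFun_creationTime (h := 0) measurable_zero m).comp (φ := fun z => (z.1, (1 : ℝ≥0∞)))
      (ψ := id) (by fun_prop) measurable_id
  have h := hS.setLIntegral_popEvent hβ measurable_one hind t
  rw [hS.decay_one hβ, if_pos ht] at h
  simpa using h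

lemma hasSum_yuleProb (hβ : 0 < β) (ht : 0 ≤ t) : HasSum (fun m => yuleProb β m t) 1 := by
  have hx := Real.exp_pos (-(β * t))
  have h := (hasSum_geometric_of_lt_one (sub_nonneg.2 (exp_neg_mul_le_one hβ ht))
    (show 1 - Real.exp (-(β * t)) < 1 by linarith)).mul_left (Real.exp (-(β * t)))
  rwa [sub_sub_cancel, mul_inv_cancel₀ hx.ne'] at h

/-- Non-explosion: the probabilities of the events `popEvent S t m` sum to `1`. Paths with
infinitely many webpages, for which `ncard` would return `0`, are therefore negligible. -/
lemma IsYuleHolding.lintegral_eq_tsum (hS : IsYuleHolding P β S) (hβ : 0 < β) (ht : 0 ≤ t)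
    (f : Ω → ℝ≥0∞) : ∫⁻ ω, f ω ∂P = ∑' m, ∫⁻ ω in popEvent S t m, f ω ∂P := by
  have hm := measurableSet_popEvent hS.measurable t
  have h1 : P (⋃ m, popEvent S t m) = 1 := by
    rw [measure_iUnion (pairwise_disjoint_popEvent S t) hm]
    simp_rw [hS.measure_popEvent hβ ht]
    have h2 := hasSum_yuleProb hβ ht
    rw [← ENNReal.ofReal_tsum_of_nonneg (fun m => yuleProb_nonneg hβ m ht) h2.summable, h2.tsum_eq,
      ENNReal.ofReal_one]
  rw [← lintegral_iUnion hm (pairwise_disjoint_popEvent S t), ← setLIntegral_univ]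
  refine setLIntegral_congr (ae_eq_univ.2 ?_).symm
  rw [prob_compl_eq_zero_iff (MeasurableSet.iUnion hm)]
  exact h1

end Population

/-! ### Sampling a right-continuous process at an independent time -/

section Sampling

/-- The index of the first point of the grid `{1 / (j + 1), 2 / (j + 1), …}` after `s`. -/
noncomputable def gridIndex (j : ℕ) (s : ℝ≥0) : ℕ := ⌊s * (j + 1)⌋₊

/-- The points of the grid of mesh `1 / (j + 1)`. -/
noncomputable def gridPoint (j q : ℕ) : ℝ≥0 := (q + 1) / (j + 1)

lemma measurable_gridIndex (j : ℕ) : Measurable (gridIndex j) :=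
  Nat.measurable_floor.comp (by fun_prop)

lemma le_gridPoint (j : ℕ) (s : ℝ≥0) : s ≤ gridPoint j (gridIndex j s) := by
  rw [gridPoint, le_div_iff₀ (by positivity)]
  exact (Nat.lt_floor_add_one _).le

lemma gridPoint_le (j : ℕ) (s : ℝ≥0) : gridPoint j (gridIndex j s) ≤ s + 1 / (j + 1) := by
  rw [gridPoint, div_le_iff₀ (by positivity), add_mul, one_div_mul_cancel (by positivity)]
  exact add_le_add_left (Nat.floor_le (by positivity)) 1

lemma tendsto_gridPoint (s : ℝ≥0) :
    Tendsto (fun j => gridPoint j (gridIndex j s)) atTop (𝓝 s) := by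
  refine tendsto_of_tendsto_of_tendsto_of_le_of_le tendsto_const_nhds ?_
    (fun j => le_gridPoint j s) (fun j => gridPoint_le j s)
  simpa using (tendsto_one_div_add_atTop_nhds_zero_nat (𝕜 := ℝ≥0)).const_add s

lemma eventually_apply_gridPoint_eq {f : ℝ≥0 → ℕ}
    (hf : ∀ s, ContinuousWithinAt f (Set.Ici s) s) (s : ℝ≥0) :
    ∀ᶠ j in atTop, f (gridPoint j (gridIndex j s)) = f s := by
  have h : Tendsto (fun j => gridPoint j (gridIndex j s)) atTop (𝓝[Set.Ici s] s) :=
    tendsto_nhdsWithin_iff.2 ⟨tendsto_gridPoint s, Eventually.of_forall fun j => le_gridPoint j s⟩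
  have h2 := (hf s).tendsto.comp h
  rw [nhds_discrete] at h2
  exact tendsto_pure.1 h2

lemma measurable_eval_countable {Ω : Type*} [MeasurableSpace Ω] {V : ℕ → Ω → ℕ}
    (hV : ∀ q, Measurable (V q)) {i : Ω → ℕ} (hi : Measurable i) :
    Measurable fun ω => V (i ω) ω :=
  (measurable_from_prod_countable_left (f := fun z : Ω × ℕ => V z.2 z.1) hV).comp
    (measurable_id.prodMk hi)

lemma measurable_sample {Ω : Type*} [MeasurableSpace Ω] {Y : ℝ≥0 → Ω → ℕ}
    (hY : ∀ s, Measurable (Y s)) (hrc : ∀ ω s, ContinuousWithinAt (fun u => Y u ω) (Set.Ici s) s)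
    {τ : Ω → ℝ≥0} (hτ : Measurable τ) : Measurable fun ω => Y (τ ω) ω := by
  refine measurable_of_tendsto_metrizable
    (f := fun j ω => Y (gridPoint j (gridIndex j (τ ω))) ω) (fun j => ?_) ?_
  · exact measurable_eval_countable (V := fun q => Y (gridPoint j q)) (fun q => hY _)
      ((measurable_gridIndex j).comp hτ)
  · refine tendsto_pi_nhds.2 fun ω => ?_
    refine tendsto_const_nhds.congr' ?_
    filter_upwards [eventually_apply_gridPoint_eq (hrc ω) (τ ω)] with j hj using hj.symm

/-- Evaluation at a random time is not measurable on the full product space of paths, so Fubini does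
not apply directly. On a grid only countably many coordinates matter and Fubini gives the formula;
grid times decrease to the sampled time within the mesh, so right-continuity handles the left side
and continuity of `π` the right side. -/
lemma measure_sample {Ω 𝓤 : Type*} [MeasurableSpace Ω] [MeasurableSpace 𝓤] {P : Measure Ω}
    [IsProbabilityMeasure P] {Y : ℝ≥0 → Ω → ℕ} (hY : ∀ s, Measurable (Y s))
    (hrc : ∀ ω s, ContinuousWithinAt (fun u => Y u ω) (Set.Ici s) s) {U : Ω → 𝓤}
    (hU : Measurable U) (hind : IndepFun U (fun ω s => Y s ω) P) {τ : 𝓤 → ℝ≥0} (hτ : Measurable τ)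
    {B : Set 𝓤} (hB : MeasurableSet B) {n : ℕ} {π : ℝ≥0 → ℝ≥0∞} (hπc : Continuous π)
    (hπ : ∀ s, P {ω | Y s ω = n} = π s) :
    P (U ⁻¹' B ∩ {ω | Y (τ (U ω)) ω = n}) = ∫⁻ ω in U ⁻¹' B, π (τ (U ω)) ∂P := by
  have hBU : MeasurableSet (U ⁻¹' B) := hU hB
  have hτU : Measurable fun ω => τ (U ω) := hτ.comp hU
  have hgrid : ∀ j, P (U ⁻¹' B ∩ {ω | Y (gridPoint j (gridIndex j (τ (U ω)))) ω = n})
      = ∫⁻ ω in U ⁻¹' B, π (gridPoint j (gridIndex j (τ (U ω)))) ∂P := by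
    intro j
    set V : Ω → ℕ → ℕ := fun ω q => Y (gridPoint j q) ω with hV
    have hVm : Measurable V := measurable_pi_lambda _ fun q => hY _
    have hψ : Measurable fun (x : ℝ≥0 → ℕ) (q : ℕ) => x (gridPoint j q) :=
      measurable_pi_lambda _ fun q => measurable_pi_apply _
    have hindV : IndepFun U V P := hind.comp measurable_id hψ
    set D : Set (𝓤 × (ℕ → ℕ)) := {z | z.1 ∈ B ∧ z.2 (gridIndex j (τ z.1)) = n} with hD
    have hDm : MeasurableSet D := by
      refine (measurable_fst hB).inter ?_
      refine measurable_eval_countable (V := fun q (z : 𝓤 × (ℕ → ℕ)) => z.2 q)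
        (fun q => by fun_prop) (i := fun z => gridIndex j (τ z.1))
        ((measurable_gridIndex j).comp (hτ.comp measurable_fst)) (measurableSet_singleton n)
    have h1 := (indepFun_iff_map_prod_eq_prod_map_map hU.aemeasurable hVm.aemeasurable).1 hindV
    have h2 : P (U ⁻¹' B ∩ {ω | Y (gridPoint j (gridIndex j (τ (U ω)))) ω = n})
        = P.map (fun ω => (U ω, V ω)) D := by
      rw [Measure.map_apply (hU.prodMk hVm) hDm]
      rfl
    have := Measure.isProbabilityMeasure_map (μ := P) hVm.aemeasurable
    rw [h2, h1, Measure.prod_apply hDm, lintegral_map (measurable_measure_prodMk_left hDm) hU,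
      ← lintegral_indicator hBU]
    congr 1 with ω
    rw [Measure.map_apply hVm (measurable_prodMk_left hDm)]
    by_cases hω : U ω ∈ B
    · rw [Set.indicator_of_mem (by exact hω), ← hπ]
      congr 1
      ext ω'
      simp [hD, hω, hV]
    · rw [Set.indicator_of_notMem (by exact hω)]
      simp [hD, hω]
  have hπ1 : ∀ s, π s ≤ 1 := fun s => hπ s ▸ prob_le_one
  have hYg : ∀ j, Measurable fun ω => Y (gridPoint j (gridIndex j (τ (U ω)))) ω := fun j =>
    measurable_eval_countable (V := fun q => Y (gridPoint j q)) (fun q => hY _)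
      ((measurable_gridIndex j).comp hτU)
  have hlim1 : Tendsto
      (fun j => P (U ⁻¹' B ∩ {ω | Y (gridPoint j (gridIndex j (τ (U ω)))) ω = n})) atTop
      (𝓝 (P (U ⁻¹' B ∩ {ω | Y (τ (U ω)) ω = n}))) := by
    refine tendsto_measure_of_tendsto_indicator_of_isFiniteMeasure atTop P
      (fun j => hBU.inter (hYg j (measurableSet_singleton n))) fun ω => ?_
    filter_upwards [eventually_apply_gridPoint_eq (hrc ω) (τ (U ω))] with j hj
    simp only [Set.mem_inter_iff, Set.mem_ofPred_eq, hj]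
  have hlim2 : Tendsto
      (fun j => ∫⁻ ω in U ⁻¹' B, π (gridPoint j (gridIndex j (τ (U ω)))) ∂P) atTop
      (𝓝 (∫⁻ ω in U ⁻¹' B, π (τ (U ω)) ∂P)) := by
    refine tendsto_lintegral_of_dominated_convergence (fun _ => 1) (fun j => ?_)
      (fun j => Eventually.of_forall fun ω => hπ1 _) ?_ (Eventually.of_forall fun ω => ?_)
    · have : Measurable (gridPoint j) := measurable_from_top
      exact hπc.measurable.comp (this.comp ((measurable_gridIndex j).comp hτU))
    · simp
    · exact (hπc.tendsto _).comp (tendsto_gridPoint _)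
  simp_rw [hgrid] at hlim1
  exact tendsto_nhds_unique hlim1 hlim2

end Sampling

/-! ### The state probabilities of the fractional linear birth process -/

section StateProb

variable {Ω : Type*} [MeasurableSpace Ω] {P : Measure Ω} {ν lam : ℝ} {X : ℝ≥0 → Ω → ℕ}

lemma IsFractionalBirthProcess.one_le {rate : ℕ → ℝ} (hX : IsFractionalBirthProcess P ν rate X)
    (s : ℝ≥0) (ω : Ω) : 1 ≤ X s ω := by
  rw [← hX.initial ω]
  exact hX.monotone ω (zero_le : 0 ≤ s)

lemma IsFractionalBirthProcess.stateProb_zero_left {rate : ℕ → ℝ}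
    (hX : IsFractionalBirthProcess P ν rate X) (t : ℝ) : stateProb P X 0 t = 0 := by
  have h : {ω | X t.toNNReal ω = 0} = ∅ := by
    ext ω
    have := hX.one_le t.toNNReal ω
    simp only [Set.mem_ofPred_eq, Set.mem_empty_iff_false, iff_false]
    omega
  rw [stateProb, h, measureReal_empty]

lemma IsFractionalBirthProcess.continuous_stateProb {rate : ℕ → ℝ}
    (hX : IsFractionalBirthProcess P ν rate X) (n : ℕ) : Continuous (stateProb P X n) := by
  rcases n with _ | n
  · rw [show stateProb P X 0 = fun _ => 0 from funext hX.stateProb_zero_left]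
    exact continuous_const
  · have h1 : ContinuousOn (stateProb P X (n + 1)) (Set.Ici 0) := by
      intro t ht
      have h := (hX.absolutelyContinuous (n + 1) (by omega) (t + 1)
        (by linarith [Set.mem_Ici.1 ht])).continuousOn
      rw [Set.uIcc_of_le (by linarith [Set.mem_Ici.1 ht])] at h
      refine (h t ⟨ht, by linarith⟩).mono_of_mem_nhdsWithin ?_
      exact mem_nhdsWithin.2 ⟨Set.Iio (t + 1), isOpen_Iio, by simp, fun x hx => ⟨hx.2, hx.1.le⟩⟩
    -- Negative times are clamped to `0` by `toNNReal`, which extends continuity to the whole line.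
    have h2 : stateProb P X (n + 1) = fun t => stateProb P X (n + 1) (max t 0) := by
      ext t
      simp only [stateProb]
      rw [← Real.coe_toNNReal', Real.toNNReal_coe]
    rw [h2]
    exact h1.comp_continuous (by fun_prop) fun t => le_max_right t 0

lemma IsFractionalBirthProcess.isLinearBirthSolution [IsProbabilityMeasure P]
    (hν0 : 0 < ν) (hν1 : ν < 1)
    (hX : IsFractionalBirthProcess P ν (fun r => lam * r) X) :
    IsLinearBirthSolution ν lam (stateProb P X) where
  continuous := hX.continuous_stateProb
  nonneg _ _ := measureReal_nonneg
  le_one _ _ := measureReal_le_one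
  zero := hX.stateProb_zero_left
  equation n t ht := by
    have h := fracIntegral_caputoDeriv hν0 hν1 ht
      (hX.absolutelyContinuous (n + 1) (by omega) t ht)
    have h0 : stateProb P X (n + 1) 0 = if n = 0 then 1 else 0 := by
      simp only [stateProb, Real.toNNReal_zero, hX.initial]
      rcases n with _ | n <;> simp
    have h2 : fracIntegral ν (caputoDeriv ν (stateProb P X (n + 1))) t = fracIntegral ν
        (fun s => -(lam * (n + 1)) * stateProb P X (n + 1) s + lam * n * stateProb P X n s) t := by
      unfold fracIntegral
      congr 1
      rw [intervalIntegral.integral_of_le ht.le, intervalIntegral.integral_of_le ht.le]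
      refine setIntegral_congr_fun measurableSet_Ioc fun s hs => ?_
      have h3 := hX.governing (n + 1) (by omega) s hs.1
      simp only [Nat.add_sub_cancel, Nat.cast_succ] at h3
      simp only [h3]
    rw [← h0, ← h2, h]
    ring

end StateProb

/-! ### The randomly chosen webpage -/

section Chosen

variable {Ω : Type*} [MeasurableSpace Ω] {P : Measure Ω}
  {β ν t : ℝ} {rate : ℕ → ℝ} {S : ℕ → Ω → ℝ} {X : ℕ → ℝ≥0 → Ω → ℕ} {J : Ω → ℕ}

lemma IsGeneralizedYuleModel.isYuleHolding (hM : IsGeneralizedYuleModel P β ν rate S X) :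
    IsYuleHolding P β S :=
  ⟨hM.measurable_holding, hM.law_holding, hM.indep_holding⟩

lemma IsGeneralizedYuleModel.networkInfo_le (hM : IsGeneralizedYuleModel P β ν rate S X) :
    networkInfo S X ≤ (inferInstance : MeasurableSpace Ω) := by
  refine Measurable.comap_le ?_
  refine (measurable_pi_lambda _ hM.measurable_holding).prodMk ?_
  exact measurable_pi_lambda _ fun k => measurable_pi_lambda _ fun s => (hM.birth k).measurable s

/-- The event that webpage `k` has `n` in-links at time `t`. -/
def sizeEvent (S : ℕ → Ω → ℝ) (X : ℕ → ℝ≥0 → Ω → ℕ) (t : ℝ) (n k : ℕ) : Set Ω :=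
  {ω | X k (t - creationTime S k ω).toNNReal ω = n}

lemma IsGeneralizedYuleModel.measurableSet_sizeEvent
    (hM : IsGeneralizedYuleModel P β ν rate S X) (t : ℝ) (n k : ℕ) :
    MeasurableSet[networkInfo S X] (sizeEvent S X t n k) := by
  have hrc := (hM.birth k).right_continuous
  -- Measurability is needed for the network σ-algebra, not merely the ambient one, because the
  -- uniform choice is specified only on its sets.
  let _ : MeasurableSpace Ω := networkInfo S X
  have hmap : Measurable fun ω => ((fun k => S k ω), (fun k s => X k s ω)) := comap_measurable _
  have hS : ∀ k, Measurable (S k) := fun k => (measurable_pi_apply k).comp hmap.fst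
  have hX : ∀ s, Measurable (X k s) := fun s =>
    (measurable_pi_apply s).comp ((measurable_pi_apply k).comp hmap.snd)
  exact measurable_sample hX hrc
    ((measurable_creationTime hS k).const_sub t).real_toNNReal (measurableSet_singleton n)

variable [IsProbabilityMeasure P]

lemma IsGeneralizedYuleModel.measure_popEvent_inter_sizeEvent
    (hM : IsGeneralizedYuleModel P β ν rate S X) (t : ℝ) (m n k : ℕ) :
    P (popEvent S t m ∩ sizeEvent S X t n k)
      = ∫⁻ ω in popEvent S t m,
          ENNReal.ofReal (stateProb P (X 0) n (t - creationTime S k ω)) ∂P := by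
  have hc : ∀ i : ℕ, Measurable fun u : ℕ → ℝ => u i := fun i => measurable_pi_apply i
  have hψ : Measurable fun x : ℕ → ℝ≥0 → ℕ => x k := measurable_pi_apply k
  have hind : IndepFun (fun ω k => S k ω) (fun ω s => X k s ω) P :=
    hM.indep_holding_inlinks.comp measurable_id hψ
  have hst : ∀ s : ℝ≥0, P {ω | X k s ω = n} = ENNReal.ofReal (stateProb P (X 0) n s) := by
    intro s
    rw [stateProb, Real.toNNReal_coe, ofReal_measureReal]
    have hs : Measurable fun x : ℝ≥0 → ℕ => x s := measurable_pi_apply s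
    have hD : MeasurableSet {x : ℝ≥0 → ℕ | x s = n} := hs (measurableSet_singleton n)
    exact (hM.identDistrib k).measure_mem_eq hD
  exact measure_sample (hM.birth k).measurable (hM.birth k).right_continuous
    (measurable_pi_lambda _ hM.measurable_holding) hind
    (τ := fun u => (t - creationTime (fun i u => u i) k u).toNNReal)
    ((measurable_creationTime hc k).const_sub t).real_toNNReal
    (B := popEvent (fun i u => u i) t m) (measurableSet_popEvent hc t m)
    (π := fun s => ENNReal.ofReal (stateProb P (X 0) n s))
    (ENNReal.continuous_ofReal.comp
      (((hM.birth 0).continuous_stateProb n).comp NNReal.continuous_coe)) hst |>.trans (by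
      refine lintegral_congr fun ω => ?_
      simp only [stateProb, Real.toNNReal_coe]
      rfl)

lemma IsGeneralizedYuleModel.measure_choice_inter (hM : IsGeneralizedYuleModel P β ν rate S X)
    (hβ : 0 < β) (ht : 0 ≤ t) (hJ : IsUniformChoice P S X t J) (k : ℕ) {A : Set Ω}
    (hA : MeasurableSet[networkInfo S X] A) :
    P ({ω | J ω = k} ∩ A)
      = ∑' m : ℕ, if k ≤ m then ((m + 1 : ℕ) : ℝ≥0∞)⁻¹ * P (popEvent S t m ∩ A) else 0 := by
  have hA' : MeasurableSet A := hM.networkInfo_le _ hA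
  have hT : MeasurableSet {ω | creationTime S k ω ≤ t} :=
    measurableSet_le (measurable_creationTime hM.measurable_holding k) measurable_const
  rw [hJ.uniform k A hA, ← lintegral_indicator (hT.inter hA'),
    hM.isYuleHolding.lintegral_eq_tsum hβ ht]
  refine tsum_congr fun m => ?_
  have hm := measurableSet_popEvent hM.measurable_holding t m
  have h : ∀ ω ∈ popEvent S t m,
      ({ω | creationTime S k ω ≤ t} ∩ A).indicator (fun ω => (numPages S t ω : ℝ≥0∞)⁻¹) ω
        = if k ≤ m then A.indicator (fun _ => ((m + 1 : ℕ) : ℝ≥0∞)⁻¹) ω else 0 := by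
    intro ω hω
    have h1 := hω k
    by_cases hk : k ≤ m
    · rw [if_pos hk]
      by_cases hωA : ω ∈ A
      · have hin : ω ∈ {ω | creationTime S k ω ≤ t} ∩ A := ⟨h1.2 hk, hωA⟩
        rw [Set.indicator_of_mem hin, Set.indicator_of_mem hωA, numPages_of_mem_popEvent hω]
      · rw [Set.indicator_of_notMem fun h => hωA h.2, Set.indicator_of_notMem hωA]
    · rw [if_neg hk, Set.indicator_of_notMem fun h => hk (h1.1 h.1)]
  rw [setLIntegral_congr_fun hm h]
  split_ifs
  · rw [lintegral_indicator_const hA', Measure.restrict_apply hA', Set.inter_comm]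
  · simp

/-- The normalizing factor of the law of the chosen webpage. -/
noncomputable def choiceFactor (β t : ℝ) : ℝ≥0∞ :=
  ∑' m : ℕ, ((m + 1 : ℕ) : ℝ≥0∞)⁻¹ * ENNReal.ofReal (yuleWeight β m t)

/-- Stated for general `A` and `h` so that the same computation gives both the numerator and the
denominator of `condSizeProb`. Summing over labels on each population event produces `jumpSum`, and
`choiceFactor` does not involve `h`. -/
lemma IsGeneralizedYuleModel.measure_ne_zero_inter (hM : IsGeneralizedYuleModel P β ν rate S X)
    (hβ : 0 < β) (ht : 0 ≤ t) (hJ : IsUniformChoice P S X t J) {A : ℕ → Set Ω}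
    (hA : ∀ k, MeasurableSet[networkInfo S X] (A k)) {h : ℝ → ℝ} (hh : Continuous h)
    (h0 : ∀ s, 0 ≤ h s) (hAh : ∀ m k, P (popEvent S t m ∩ A k)
      = ∫⁻ ω in popEvent S t m, ENNReal.ofReal (h (creationTime S k ω)) ∂P) :
    P ({ω | J ω ≠ 0} ∩ {ω | ω ∈ A (J ω)}) = choiceFactor β t * ENNReal.ofReal (ageIntegral β h t) := by
  have hU : {ω | J ω ≠ 0} ∩ {ω | ω ∈ A (J ω)} = ⋃ k : ℕ, ({ω | J ω = k + 1} ∩ A (k + 1)) := by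
    ext ω
    simp only [Set.mem_inter_iff, Set.mem_ofPred_eq, Set.mem_iUnion]
    constructor
    · rintro ⟨h1, h2⟩
      obtain ⟨k, hk⟩ := Nat.exists_eq_succ_of_ne_zero h1
      exact ⟨k, hk, by rwa [← Nat.succ_eq_add_one, ← hk]⟩
    · rintro ⟨k, h1, h2⟩
      exact ⟨by omega, by rwa [h1]⟩
  have hd : Pairwise (Function.onFun Disjoint fun k : ℕ => {ω | J ω = k + 1} ∩ A (k + 1)) := by
    intro k k' hne
    refine Set.disjoint_left.2 fun ω h1 h2 => hne ?_
    have := h1.1.symm.trans h2.1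
    omega
  rw [hU, measure_iUnion hd fun k =>
    (hJ.measurable (measurableSet_singleton (k + 1))).inter (hM.networkInfo_le _ (hA (k + 1)))]
  simp_rw [hM.measure_choice_inter hβ ht hJ _ (hA _), hAh]
  rw [ENNReal.tsum_comm, choiceFactor, ← ENNReal.tsum_mul_right]
  refine tsum_congr fun m => ?_
  rw [tsum_eq_sum (s := Finset.range m)
    (fun k hk => if_neg (by rw [Finset.mem_range] at hk; omega))]
  have h1 : ∀ k ∈ Finset.range m, (if k + 1 ≤ m then ((m + 1 : ℕ) : ℝ≥0∞)⁻¹ *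
      ∫⁻ ω in popEvent S t m, ENNReal.ofReal (h (creationTime S (k + 1) ω)) ∂P else 0)
      = ((m + 1 : ℕ) : ℝ≥0∞)⁻¹ *
      ∫⁻ ω in popEvent S t m, ENNReal.ofReal (h (creationTime S (k + 1) ω)) ∂P :=
    fun k hk => if_pos (Finset.mem_range.1 hk)
  rw [Finset.sum_congr rfl h1, ← Finset.mul_sum, ← lintegral_finsetSum]
  swap
  · intro k _
    exact (hh.measurable.comp (measurable_creationTime hM.measurable_holding (k + 1))).ennreal_ofReal
  have h2 := hM.isYuleHolding.setLIntegral_jumpSum hβ hh h0 ht m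
  unfold jumpSum at h2
  rw [h2, ENNReal.ofReal_mul (yuleWeight_nonneg hβ m ht), mul_assoc]

lemma ageIntegral_one (hβ : 0 < β) (t : ℝ) :
    ageIntegral β (fun _ => 1) t = Real.exp (β * t) - 1 := by
  unfold ageIntegral
  simp only [mul_one]
  rw [intervalIntegral.integral_const_mul, intervalIntegral.integral_comp_mul_left _ hβ.ne',
    integral_exp, smul_eq_mul, mul_inv_cancel_left₀ hβ.ne', mul_zero, Real.exp_zero]

lemma ageIntegral_comp_sub (β t : ℝ) (p : ℝ → ℝ) :
    ageIntegral β (fun s => p (t - s)) t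
      = Real.exp (β * t) * ∫ y in (0 : ℝ)..t, β * Real.exp (-β * y) * p y := by
  have h := intervalIntegral.integral_comp_sub_left
    (fun y => Real.exp (β * t) * (β * Real.exp (-β * y) * p y)) t (a := 0) (b := t)
  rw [sub_self, sub_zero] at h
  rw [ageIntegral, ← intervalIntegral.integral_const_mul, ← h]
  congr 1 with s
  rw [show β * s = β * t + -β * (t - s) by ring, Real.exp_add]
  ring

variable (hM : IsGeneralizedYuleModel P β ν rate S X) (hβ : 0 < β) (ht : 0 < t)
  (hJ : IsUniformChoice P S X t J)

include hM hβ ht hJ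

lemma IsGeneralizedYuleModel.measure_ne_zero :
    P {ω | J ω ≠ 0} = choiceFactor β t * ENNReal.ofReal (Real.exp (β * t) - 1) := by
  have h := hM.measure_ne_zero_inter hβ ht.le hJ (A := fun _ => Set.univ)
    (fun _ => MeasurableSet.univ) (h := fun _ => 1) continuous_const (fun _ => zero_le_one)
    (fun m k => by simp)
  rw [ageIntegral_one hβ] at h
  simpa using h

lemma IsGeneralizedYuleModel.measure_ne_zero_inter_chosenSize (n : ℕ) :
    P ({ω | J ω ≠ 0} ∩ {ω | chosenSize S X t J ω = n})
      = choiceFactor β t * ENNReal.ofReal (Real.exp (β * t) *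
          ∫ y in (0 : ℝ)..t, β * Real.exp (-β * y) * stateProb P (X 0) n y) := by
  have hc := (hM.birth 0).continuous_stateProb n
  have h := hM.measure_ne_zero_inter hβ ht.le hJ (A := sizeEvent S X t n)
    (hM.measurableSet_sizeEvent t n) (h := fun s => stateProb P (X 0) n (t - s)) (by fun_prop)
    (fun _ => measureReal_nonneg) (fun m k => hM.measure_popEvent_inter_sizeEvent t m n k)
  rw [ageIntegral_comp_sub] at h
  exact h

lemma IsGeneralizedYuleModel.condSizeProb_eq (n : ℕ) :
    condSizeProb P S X t J n = 1 / (1 - Real.exp (-β * t)) *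
      ∫ y in (0 : ℝ)..t, β * Real.exp (-β * y) * stateProb P (X 0) n y := by
  set I := ∫ y in (0 : ℝ)..t, β * Real.exp (-β * y) * stateProb P (X 0) n y with hI
  have hI0 : 0 ≤ I := intervalIntegral.integral_nonneg ht.le fun y _ =>
    mul_nonneg (by positivity) measureReal_nonneg
  have hJm : MeasurableSet {ω | J ω ≠ 0} := (hJ.measurable (measurableSet_singleton 0)).compl
  have h1 := hM.measure_ne_zero hβ ht hJ
  have h2 := hM.measure_ne_zero_inter_chosenSize hβ ht hJ n
  rw [← hI] at h2
  clear_value I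
  have hw : 0 < Real.exp (β * t) - 1 := sub_pos.2 (Real.one_lt_exp_iff.2 (by positivity))
  -- The factor is never evaluated: it is nonzero by its term `m = 1`, and finite because its
  -- product with a positive number is a probability.
  have hC0 : choiceFactor β t ≠ 0 := by
    intro h
    have h3 := ENNReal.tsum_eq_zero.1 h 1
    rw [mul_eq_zero] at h3
    rcases h3 with h3 | h3
    · simp at h3
    · rw [ENNReal.ofReal_eq_zero] at h3
      have : 0 < yuleWeight β 1 t := by
        simp only [yuleWeight]
        simp only [Nat.sub_self, pow_zero, Nat.cast_one, one_mul]
        positivity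
      linarith
  have hCt : choiceFactor β t ≠ ⊤ := by
    intro h
    have h3 : P {ω | J ω ≠ 0} ≤ 1 := prob_le_one
    rw [h1, h, ENNReal.top_mul (by simpa using hw)] at h3
    exact absurd h3 (by simp)
  have hC : (choiceFactor β t).toReal ≠ 0 := (ENNReal.toReal_pos hC0 hCt).ne'
  rw [condSizeProb, measureReal_def, cond_apply hJm, h1, h2, ENNReal.toReal_mul, ENNReal.toReal_inv,
    ENNReal.toReal_mul, ENNReal.toReal_mul, ENNReal.toReal_ofReal hw.le,
    ENNReal.toReal_ofReal (by positivity)]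
  have e : Real.exp (-β * t) = (Real.exp (β * t))⁻¹ := by rw [neg_mul, Real.exp_neg]
  have hE := Real.exp_pos (β * t)
  have hw' : 1 - (Real.exp (β * t))⁻¹ ≠ 0 := by
    rw [← mul_ne_zero_iff_right hE.ne', sub_mul, inv_mul_cancel₀ hE.ne', one_mul]
    exact hw.ne'
  rw [e]
  have hw2 := hw.ne'
  field_simp

lemma IsGeneralizedYuleModel.measure_eq_zero :
    P.real {ω | J ω = 0} = Real.exp (-(β * t)) / (1 - Real.exp (-(β * t))) * (β * t) := by
  have h := hM.measure_choice_inter hβ ht.le hJ 0 (A := Set.univ) MeasurableSet.univ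
  simp only [Set.inter_univ, zero_le, if_true, hM.isYuleHolding.measure_popEvent hβ ht.le] at h
  have hx0 : Real.exp (-(β * t)) < 1 := Real.exp_lt_one_iff.2 (by nlinarith)
  have hx1 := Real.exp_pos (-(β * t))
  set x := 1 - Real.exp (-(β * t)) with hx
  have hxp : 0 < x := by linarith
  -- With `x = 1 - e^{-βt}`, the weights `1 / (m + 1)` turn the geometric law into the logarithmic
  -- series, and `-log (1 - x) = βt`.
  have hs := (Real.hasSum_pow_div_log_of_abs_lt_one (x := x) (by
    rw [abs_of_pos hxp]; linarith)).mul_left (Real.exp (-(β * t)) / x)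
  rw [hx, sub_sub_cancel, Real.log_exp, neg_neg, ← hx] at hs
  have e : ∀ m : ℕ, ((m + 1 : ℕ) : ℝ≥0∞)⁻¹ * ENNReal.ofReal (yuleProb β m t)
      = ENNReal.ofReal (Real.exp (-(β * t)) / x * (x ^ (m + 1) / (m + 1))) := by
    intro m
    rw [← ENNReal.ofReal_natCast, ← ENNReal.ofReal_inv_of_pos (by positivity),
      ← ENNReal.ofReal_mul (by positivity), yuleProb, ← hx]
    congr 1
    push_cast
    field_simp
    ring
  simp_rw [e] at h
  rw [measureReal_def, h, ← ENNReal.ofReal_tsum_of_nonneg (fun m => by positivity) hs.summable,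
    hs.tsum_eq, ENNReal.toReal_ofReal (by positivity)]

end Chosen

/-! ### Passage to the limit and negligibility of the initial webpage -/

section Limit

lemma sum_Icc_choose_eq_sum_range (n : ℕ) (f : ℕ → ℝ) :
    ∑ j ∈ Finset.Icc 1 n, ((n - 1).choose (j - 1) : ℝ) * (-1) ^ (j - 1) * f j
      = ∑ j ∈ Finset.range n, ((n - 1).choose j : ℝ) * (-1) ^ j * f (j + 1) := by
  refine Finset.sum_nbij' (fun j => j - 1) (fun j => j + 1) ?_ ?_ ?_ ?_ ?_
  · intro j hj
    rw [Finset.mem_Icc] at hj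
    rw [Finset.mem_range]
    omega
  · intro j hj
    rw [Finset.mem_range] at hj
    rw [Finset.mem_Icc]
    omega
  · intro j hj
    rw [Finset.mem_Icc] at hj
    omega
  · intro j _
    omega
  · intro j hj
    rw [Finset.mem_Icc] at hj
    simp only [Nat.sub_add_cancel hj.1]

lemma tendsto_exp_neg_mul_atTop {β : ℝ} (hβ : 0 < β) :
    Tendsto (fun t => Real.exp (-β * t)) atTop (𝓝 0) := by
  simp_rw [neg_mul]
  exact Real.tendsto_exp_neg_atTop_nhds_zero.comp (tendsto_id.const_mul_atTop hβ)

variable {Ω : Type*} [MeasurableSpace Ω] {P : Measure Ω}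
  {β ν : ℝ} {rate : ℕ → ℝ} {S : ℕ → Ω → ℝ} {X : ℕ → ℝ≥0 → Ω → ℕ} {J : ℝ → Ω → ℕ}

lemma IsGeneralizedYuleModel.stateProb_eq (hM : IsGeneralizedYuleModel P β ν rate S X) (k : ℕ) :
    stateProb P (X k) = stateProb P (X 0) := by
  ext n s
  have hs : Measurable fun x : ℝ≥0 → ℕ => x s.toNNReal := measurable_pi_apply _
  have hD : MeasurableSet {x : ℝ≥0 → ℕ | x s.toNNReal = n} := hs (measurableSet_singleton n)
  exact congrArg ENNReal.toReal ((hM.identDistrib k).measure_mem_eq hD)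

variable [IsProbabilityMeasure P]

lemma IsGeneralizedYuleModel.tendsto_measure_eq_zero
    (hM : IsGeneralizedYuleModel P β ν rate S X) (hβ : 0 < β)
    (hJ : ∀ t : ℝ, 0 < t → IsUniformChoice P S X t (J t)) :
    Tendsto (fun t => P.real {ω | J t ω = 0}) atTop (𝓝 0) := by
  have h1 : Tendsto (fun t => (β * t) ^ 1 * Real.exp (-(β * t))) atTop (𝓝 0) :=
    (Real.tendsto_pow_mul_exp_neg_atTop_nhds_zero 1).comp (tendsto_id.const_mul_atTop hβ)
  have h2 := h1.div ((tendsto_exp_neg_mul_atTop hβ).const_sub 1) (by simp)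
  rw [zero_div] at h2
  refine h2.congr' ?_
  filter_upwards [eventually_gt_atTop 0] with t ht
  rw [hM.measure_eq_zero hβ ht (hJ t ht)]
  simp only [Pi.div_apply, pow_one, neg_mul]
  ring

lemma IsGeneralizedYuleModel.tendsto_chosenSize
    (hM : IsGeneralizedYuleModel P β ν rate S X) (hβ : 0 < β)
    (hJ : ∀ t : ℝ, 0 < t → IsUniformChoice P S X t (J t)) {n : ℕ} {q : ℝ}
    (hq : Tendsto (fun t => condSizeProb P S X t (J t) n) atTop (𝓝 q)) :
    Tendsto (fun t => P.real {ω | chosenSize S X t (J t) ω = n}) atTop (𝓝 q) := by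
  have h0 := hM.tendsto_measure_eq_zero hβ hJ
  have h1 : Tendsto (fun t => P.real ({ω | chosenSize S X t (J t) ω = n} ∩ {ω | J t ω = 0}))
      atTop (𝓝 0) :=
    squeeze_zero (fun _ => measureReal_nonneg)
      (fun t => measureReal_mono Set.inter_subset_right) h0
  -- Splitting on `J = 0` writes the unconditional probability as a vanishing part plus `P(J ≠ 0)`
  -- times the conditional one. Only the event `J = 0` has to be measurable.
  have h2 := h1.add ((h0.const_sub 1).mul hq)
  rw [sub_zero, one_mul, zero_add] at h2
  refine h2.congr' ?_
  have hlt : ∀ᶠ t in atTop, P.real {ω | J t ω = 0} < 1 := h0.eventually_lt_const one_pos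
  filter_upwards [eventually_gt_atTop 0, hlt] with t ht hlt
  have hm : MeasurableSet {ω | J t ω = 0} := (hJ t ht).measurable (measurableSet_singleton 0)
  have hne : {ω | J t ω ≠ 0} = {ω | J t ω = 0}ᶜ := rfl
  have h3 : P.real {ω | J t ω ≠ 0} = 1 - P.real {ω | J t ω = 0} := by
    rw [hne, measureReal_compl hm, probReal_univ]
  have h4 : condSizeProb P S X t (J t) n = (P.real {ω | J t ω ≠ 0})⁻¹ *
      P.real ({ω | chosenSize S X t (J t) ω = n} \ {ω | J t ω = 0}) := by
    rw [condSizeProb, measureReal_def, cond_apply (hne ▸ hm.compl), ENNReal.toReal_mul,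
      ENNReal.toReal_inv, Set.inter_comm, hne, ← Set.sdiff_eq]
    rfl
  rw [h4, ← h3, mul_inv_cancel_left₀ (by rw [h3]; linarith), measureReal_inter_add_sdiff hm]

end Limit

end FractionalYule

/-! ### The main theorem -/

open FractionalYule

theorem mainTheorem4 {Ω : Type*} [MeasurableSpace Ω] (P : Measure Ω) [IsProbabilityMeasure P]
    (β ν lam : ℝ) (hβ : 0 < β) (hν0 : 0 < ν) (hν1 : ν < 1) (hlam : 0 < lam)
    (S : ℕ → Ω → ℝ) (X : ℕ → ℝ≥0 → Ω → ℕ) (J : ℝ → Ω → ℕ)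
    (hmodel : FractionalYule.IsGeneralizedYuleModel P β ν (fun r => lam * r) S X)
    (hJ : ∀ t : ℝ, 0 < t → FractionalYule.IsUniformChoice P S X t (J t)) :
    -- the finite-time distribution
    (∀ t : ℝ, 0 < t → ∀ n : ℕ, 1 ≤ n →
      (∀ k : ℕ,
        IntegrableOn (fun y => Real.exp (-β * y) * FractionalYule.stateProb P (X k) n y)
          (Set.Ioi t) ∧
        FractionalYule.condSizeProb P S X t (J t) n
          = β / (1 - Real.exp (-β * t)) *
            (β ^ (ν - 1) / lam *
                (Real.Gamma (β ^ ν / lam + 1) * Real.Gamma n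
                  / Real.Gamma (β ^ ν / lam + n + 1))
              - ∫ y in Set.Ioi t,
                  Real.exp (-β * y) * FractionalYule.stateProb P (X k) n y)) ∧
      (∀ j : ℕ, 1 ≤ j → Summable (FractionalYule.lowerTerm β ν lam t j)) ∧
      FractionalYule.condSizeProb P S X t (J t) n
        = 1 / (1 - Real.exp (-β * t)) *
          ∑ j ∈ Finset.Icc 1 n, ((n - 1).choose (j - 1) : ℝ) * (-1) ^ (j - 1) *
            ∑' r : ℕ, FractionalYule.lowerTerm β ν lam t j r ∧
      (∀ j : ℕ, 1 ≤ j →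
        (Summable (FractionalYule.upperTerm β ν lam t j) ↔ lam * j < β ^ ν)) ∧
      (lam * n < β ^ ν →
        FractionalYule.condSizeProb P S X t (J t) n
          = 1 / (1 - Real.exp (-β * t)) *
            (β ^ ν / lam *
                (Real.Gamma (β ^ ν / lam + 1) * Real.Gamma n
                  / Real.Gamma (β ^ ν / lam + n + 1))
              - ∑ j ∈ Finset.Icc 1 n, ((n - 1).choose (j - 1) : ℝ) * (-1) ^ (j - 1) *
                  ∑' r : ℕ, FractionalYule.upperTerm β ν lam t j r))) ∧
    -- the limiting distribution
    (∀ n : ℕ, 1 ≤ n →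
      Tendsto (fun t : ℝ => FractionalYule.condSizeProb P S X t (J t) n) atTop
        (𝓝 (FractionalYule.yuleSimon (β ^ ν / lam) n)) ∧
      Tendsto (fun t : ℝ => P.real {ω | FractionalYule.chosenSize S X t (J t) ω = n}) atTop
        (𝓝 (FractionalYule.yuleSimon (β ^ ν / lam) n))) ∧
    -- the limit is a probability distribution on the positive integers
    HasSum (fun m : ℕ => FractionalYule.yuleSimon (β ^ ν / lam) (m + 1)) 1 := by
  have hsol := fun k => (hmodel.birth k).isLinearBirthSolution hν0 hν1
  have hb := Real.rpow_pos_of_pos hβ ν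
  have ha : 0 < β ^ ν / lam := div_pos hb hlam
  have hlap : ∀ n, 1 ≤ n → ∫ y in Set.Ioi 0, Real.exp (-β * y) * stateProb P (X 0) n y
      = β ^ (ν - 1) / lam * (Real.Gamma (β ^ ν / lam + 1) * Real.Gamma n
          / Real.Gamma (β ^ ν / lam + n + 1)) := by
    intro n hn
    obtain ⟨m, rfl⟩ := Nat.exists_eq_add_of_le' hn
    exact (hsol 0).laplace_eq hβ hν0 hlam m
  have hq : ∀ t, 0 < t → ∀ n, condSizeProb P S X t (J t) n = β / (1 - Real.exp (-β * t)) *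
      ∫ y in (0 : ℝ)..t, Real.exp (-β * y) * stateProb P (X 0) n y := by
    intro t ht n
    rw [hmodel.condSizeProb_eq hβ ht (hJ t ht)]
    simp_rw [mul_assoc]
    rw [intervalIntegral.integral_const_mul]
    ring
  have hlim : ∀ n, 1 ≤ n → Tendsto (fun t : ℝ => condSizeProb P S X t (J t) n) atTop
      (𝓝 (yuleSimon (β ^ ν / lam) n)) := by
    intro n hn
    have h1 := intervalIntegral_tendsto_integral_Ioi 0 ((hsol 0).integrableOn_exp_mul hβ n 0)
      tendsto_id
    have h2 := (tendsto_const_nhds (x := β)).div ((tendsto_exp_neg_mul_atTop hβ).const_sub 1)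
      (by simp)
    have h3 := h2.mul h1
    have e : β / (1 - 0) * ∫ y in Set.Ioi 0, Real.exp (-β * y) * stateProb P (X 0) n y
        = yuleSimon (β ^ ν / lam) n := by
      rw [hlap n hn, yuleSimon, Real.rpow_sub_one hβ.ne', sub_zero, div_one]
      field_simp
    rw [e] at h3
    refine h3.congr' ?_
    filter_upwards [eventually_gt_atTop 0] with t ht using (hq t ht n).symm
  refine ⟨fun t ht n hn => ?_, fun n hn => ⟨hlim n hn, hmodel.tendsto_chosenSize hβ hJ (hlim n hn)⟩,
    hasSum_yuleSimon ha⟩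
  have hseries : condSizeProb P S X t (J t) n = 1 / (1 - Real.exp (-β * t)) *
      ∑ j ∈ Finset.Icc 1 n, ((n - 1).choose (j - 1) : ℝ) * (-1) ^ (j - 1) *
        ∑' r : ℕ, lowerTerm β ν lam t j r := by
    rw [hmodel.condSizeProb_eq hβ ht (hJ t ht), (hsol 0).integral_exp_mul_eq hβ hν0 hlam ht,
      sum_Icc_choose_eq_sum_range n fun j => ∑' r : ℕ, lowerTerm β ν lam t j r]
  refine ⟨fun k => ⟨(hsol k).integrableOn_exp_mul hβ n t, ?_⟩,
    fun j _ => summable_lowerTerm hβ hν0 ht j, hseries,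
    fun j _ => summable_upperTerm_iff hβ hν0 hlam ht j, fun hn' => ?_⟩
  · rw [hmodel.stateProb_eq k, hq t ht, ← hlap n hn, ← intervalIntegral.integral_interval_add_Ioi
      ((hsol 0).integrableOn_exp_mul hβ n 0) ((hsol 0).integrableOn_exp_mul hβ n t),
      add_sub_cancel_right]
  · rw [hseries]
    congr 1
    obtain ⟨m, rfl⟩ := Nat.exists_eq_add_of_le' hn
    -- The closed form is rewritten as the alternating sum of the geometric values `a / (a + j)`, so
    -- that the two sides agree for each `j`; `lam * n < β ^ ν` gives convergence for every `j ≤ n`.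
    have h := sum_choose_div_eq_yuleSimon ha m
    rw [yuleSimon] at h
    rw [sum_Icc_choose_eq_sum_range (m + 1) fun j => ∑' r : ℕ, lowerTerm β ν lam t j r,
      sum_Icc_choose_eq_sum_range (m + 1) fun j => ∑' r : ℕ, upperTerm β ν lam t j r, ← h,
      Nat.add_sub_cancel, ← Finset.sum_sub_distrib]
    refine Finset.sum_congr rfl fun j hj => ?_
    have hj' : lam * ((j + 1 : ℕ) : ℝ) < β ^ ν := by
      refine lt_of_le_of_lt ?_ hn'
      have : j + 1 ≤ m + 1 := Finset.mem_range.1 hj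
      gcongr
    rw [tsum_upperTerm hβ hν0 hlam ht hj']
    ring
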